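/- **Theorem (Construction of a restricted EPPA-witness).** Let $L$ be a language consisting of relation symbols (of arities $\ge 1$) and unary function symbols, equipped with a permutation group $\Gamma_L$, i.e. a group of permutations of $L$ preserving types and arities of symbols. A $\Gamma_L$-structure $\mathbf A$ has a vertex set $A$, a relation $R_{\mathbf A}\subseteq A^{a(R)}$ for every relation symbol $R$ of arity $a(R)$, and a function $F_{\mathbf A}\colon A\to\mathcal P(A)$ for every function symbol $F$. A *homomorphism* $f\colon\mathbf A\to\mathbf B$ is a pair $(f_L,f_A)$ with $f_L\in\Gamma_L$ and $f_A\colon A\to B$ such that $\bar x\in R_{\mathbf A}$ implies $f_A(\bar x)\in f_L(R)_{\mathbf B}$, and $f_A(F_{\mathbf A}(x))\subseteq f_L(F)_{\mathbf B}(f_A(x))$. It is an *embedding* if $f_A$ is injective, the implication is an equivalence and the inclusion is an equality; it is an *isomorphism* if moreover $f_A$ is onto. A *substructure* of $\mathbf A$ is a (possibly empty) subset of $A$ closed under all $F_{\mathbf A}$ with the induced structure. Homomorphisms are composed in both components. Given embeddings $\alpha_i\colon\mathbf D\to\mathbf B_i$ ($i=1,2$), a structure $\mathbf C$ with embeddings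 $\beta_i\colon\mathbf B_i\to\mathbf C$ is the *free amalgamation* of $\mathbf B_1,\mathbf B_2$ over $\mathbf D$ with respect to $\alpha_1,\alpha_2$ if $\beta_1\circ\alpha_1=\beta_2\circ\alpha_2$, $\beta_1(B_1)\cap\beta_2(B_2)=\beta_1(\alpha_1(D))$, $C=\beta_1(B_1)\cup\beta_2(B_2)$, and no tuple in a relation of $\mathbf C$ contains vertices of both $\beta_1(B_1\setminus\alpha_1(D))$ and $\beta_2(B_2\setminus\alpha_2(D))$. A structure is *irreducible* if it is not the free amalgamation of two proper substructures over their intersection (with inclusions as embeddings). A *homomorphism-embedding* is a homomorphism whose restriction to every irreducible substructure of its domain is an embedding. *Tree amalgamations of copies of $\mathbf A$* are defined recursively: every structure isomorphic to $\mathbf A$ is one; and if $\mathbf B_1,\mathbf B_2$ are tree amalgamations of copies of $\mathbf A$, and $\delta_1,\delta_2\colon\mathbf D\to\mathbf A$ and $\alpha_i\colon\mathbf A\to\mathbf B_i$ are embeddings, then the free amalgamation of $\mathbf B_1$ and $\mathbf B_2$ over $\mathbf D$ with respect to $\alpha_1\circ\delta_1$ and $\alpha_2\circ\delta_2$ is one.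 A *partial automorphism* of a structure is an isomorphism between two of its substructures. A finite structure $\mathbf B$ is an *EPPA-witness* for a finite structure $\mathbf A$ if there is an embedding $\psi\colon\mathbf A\to\mathbf B$ such that every partial automorphism $f$ of $\psi(\mathbf A)$ extends to an automorphism $\hat f$ of $\mathbf B$ (with the same language permutation). It is *coherent* if $\psi$ and the assignment $f\mapsto\hat f$ can be chosen so that $\hat h=\hat g\circ\hat f$ whenever $h=g\circ f$, $\mathrm{Dom}(f)=\mathrm{Dom}(h)$, $\mathrm{Range}(f)=\mathrm{Dom}(g)$ and $\mathrm{Range}(g)=\mathrm{Range}(h)$. It is *irreducible structure faithful* (with respect to $\psi(\mathbf A)$) if for every irreducible substructure $\mathbf C$ of $\mathbf B$ there is an automorphism $\theta$ of $\mathbf B$ with $\theta(C)\subseteq\psi(A)$. Let $\mathbf A$ be a finite irreducible $\Gamma_L$-structure, let $\mathbf B_0$ be a finite EPPA-witness for $\mathbf A$, and let $n\ge 1$ be an integer. Then there are a finite $\Gamma_L$-structure $\mathbf B$ and an embedding $\psi\colon\mathbf A\to\mathbf B$ such that: 1. $\mathbf B$ is an EPPA-witness for $\mathbf A$ (by means of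 $\psi$), irreducible structure faithful with respect to $\psi(\mathbf A)$. 2. There is a homomorphism-embedding $\mathbf B\to\mathbf B_0$. 3. For every substructure $\mathbf C$ of $\mathbf B$ on at most $n$ vertices there are a tree amalgamation $\mathbf D$ of copies of $\mathbf A$ and a homomorphism-embedding $\mathbf C\to\mathbf D$. 4. If $\mathbf B_0$ is a coherent EPPA-witness for $\mathbf A$, then so is $\mathbf B$ (by means of the same $\psi$). -/

import Mathlib

universe u v w w₁ w₂ w₃

/-- A language consisting of relation symbols and unary function symbols, equipped with a
permutation group `Γ`. All relations have arity at least one: `Rel k` is the set of relation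
symbols of arity `k + 1`. `Fn` is the set of (unary) function symbols. The elements of `Γ` are the
permutations of the symbols that preserve types and arities, i.e. they are given by a permutation
of every `Rel k` and a permutation of `Fn`. -/
structure PermLang where
  Rel : ℕ → Type u
  Fn : Type v
  Γ : Subgroup ((∀ k, Equiv.Perm (Rel k)) × Equiv.Perm Fn)

namespace PermLang

variable {L : PermLang.{u, v}}

/-- The image of a relation symbol under an element of the permutation group. -/
def onRel (g : L.Γ) {k : ℕ} (R : L.Rel k) : L.Rel k := g.1.1 k R

/-- The image of a function symbol under an element of the permutation group. -/
def onFn (g : L.Γ) (F : L.Fn) : L.Fn := g.1.2 F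

end PermLang

/-- A structure with vertex set `V`; the functions are unary and take subsets of `V` as values. -/
structure GStr (L : PermLang.{u, v}) (V : Type w) where
  rel : ∀ {k : ℕ}, L.Rel k → Set (Fin (k + 1) → V)
  fn : L.Fn → V → Set V

namespace GStr

variable {L : PermLang.{u, v}}
variable {V : Type w} {W : Type w₁} {X : Type w₂} {Y : Type w₃}

/-- A homomorphism is a pair of a permutation from `Γ` and a map of vertices. -/
structure Hom (A : GStr L V) (B : GStr L W) where
  lang : L.Γ
  toFun : V → W
  map_rel : ∀ {k : ℕ} (R : L.Rel k) (x : Fin (k + 1) → V),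
    x ∈ A.rel R → (fun i => toFun (x i)) ∈ B.rel (PermLang.onRel lang R)
  map_fn : ∀ (F : L.Fn) (x : V),
    toFun '' A.fn F x ⊆ B.fn (PermLang.onFn lang F) (toFun x)

instance (A : GStr L V) (B : GStr L W) : CoeFun (Hom A B) (fun _ => V → W) := ⟨Hom.toFun⟩

/-- Composition of homomorphisms, `(g.comp f) x = g (f x)`, also on the language part. -/
def Hom.comp {A : GStr L V} {B : GStr L W} {C : GStr L X} (g : Hom B C) (f : Hom A B) :
    Hom A C where
  lang := g.lang * f.lang
  toFun := fun x => g (f x)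
  map_rel := fun R x hx => g.map_rel _ _ (f.map_rel R x hx)
  map_fn := by
    rintro F x _ ⟨y, hy, rfl⟩
    exact g.map_fn _ _ ⟨f y, f.map_fn F x ⟨y, hy, rfl⟩, rfl⟩

/-- A homomorphism is an embedding if it is injective on vertices, reflects relations and
preserves the functions exactly. -/
structure Hom.IsEmbedding {A : GStr L V} {B : GStr L W} (f : Hom A B) : Prop where
  injective : Function.Injective f.toFun
  rel_iff : ∀ {k : ℕ} (R : L.Rel k) (x : Fin (k + 1) → V),
    x ∈ A.rel R ↔ (fun i => f (x i)) ∈ B.rel (PermLang.onRel f.lang R)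
  fn_eq : ∀ (F : L.Fn) (x : V),
    f.toFun '' A.fn F x = B.fn (PermLang.onFn f.lang F) (f x)

/-- An isomorphism is an embedding that is bijective on vertices. -/
structure Hom.IsIso {A : GStr L V} {B : GStr L W} (f : Hom A B) : Prop
    extends f.IsEmbedding where
  surjective : Function.Surjective f.toFun

/-- Embeddings. -/
structure Emb (A : GStr L V) (B : GStr L W) extends Hom A B where
  isEmbedding : toHom.IsEmbedding

/-- Composition of embeddings. -/
def Emb.comp {A : GStr L V} {B : GStr L W} {C : GStr L X} (g : Emb B C) (f : Emb A B) :
    Emb A C where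
  toHom := g.toHom.comp f.toHom
  isEmbedding :=
    { injective := g.isEmbedding.injective.comp f.isEmbedding.injective
      rel_iff := fun R x => (f.isEmbedding.rel_iff R x).trans (g.isEmbedding.rel_iff _ _)
      fn_eq := fun F x => by
        have h := g.isEmbedding.fn_eq (PermLang.onFn f.lang F) (f.toHom x)
        rw [← f.isEmbedding.fn_eq F x, Set.image_image] at h
        exact h }

/-- A substructure is given by a set of vertices that is closed under all functions. -/
@[ext]
structure Substr (A : GStr L V) where
  carrier : Set V
  closed : ∀ (F : L.Fn) (x : V), x ∈ carrier → A.fn F x ⊆ carrier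

/-- The structure induced by `A` on the vertices of a substructure. -/
def Substr.str {A : GStr L V} (S : Substr A) : GStr L S.carrier where
  rel := fun R => {x | (fun i => (x i : V)) ∈ A.rel R}
  fn := fun F x => {y | (y : V) ∈ A.fn F x}

/-- The intersection of two substructures. -/
def Substr.inter {A : GStr L V} (S T : Substr A) : Substr A where
  carrier := S.carrier ∩ T.carrier
  closed := fun F x hx => Set.subset_inter (S.closed F x hx.1) (T.closed F x hx.2)

/-- The inclusion of a substructure, with the identity as its language part. -/
def Substr.incl {A : GStr L V} (S : Substr A) : Emb S.str A where
  lang := 1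
  toFun := Subtype.val
  map_rel := fun _ _ hx => hx
  map_fn := by
    rintro F x _ ⟨y, hy, rfl⟩
    exact hy
  isEmbedding :=
    { injective := Subtype.val_injective
      rel_iff := fun _ _ => Iff.rfl
      fn_eq := fun F x => by
        ext y
        constructor
        · rintro ⟨z, hz, rfl⟩
          exact hz
        · intro hy
          exact ⟨⟨y, S.closed F x x.2 hy⟩, hy, rfl⟩ }

/-- The inclusion of a substructure in a larger substructure. -/
def Substr.inclusion {A : GStr L V} (S T : Substr A) (h : S.carrier ⊆ T.carrier) :
    Emb S.str T.str where
  lang := 1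
  toFun := Set.inclusion h
  map_rel := fun _ _ hx => hx
  map_fn := by
    rintro F x _ ⟨y, hy, rfl⟩
    exact hy
  isEmbedding :=
    { injective := Set.inclusion_injective h
      rel_iff := fun _ _ => Iff.rfl
      fn_eq := fun F x => by
        ext y
        constructor
        · rintro ⟨z, hz, rfl⟩
          exact hz
        · intro hy
          exact ⟨⟨y, S.closed F x x.2 hy⟩, hy, rfl⟩ }

/-- The image of an embedding, as a substructure of the target. -/
def Emb.range {A : GStr L V} {B : GStr L W} (f : Emb A B) : Substr B where
  carrier := Set.range f.toFun
  closed := by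
    rintro F _ ⟨x, rfl⟩ y hy
    have h := f.isEmbedding.fn_eq (PermLang.onFn f.lang⁻¹ F) x
    have e : PermLang.onFn f.lang (PermLang.onFn f.lang⁻¹ F) = F :=
      Equiv.apply_symm_apply f.lang.1.2 F
    rw [e] at h
    rw [← h] at hy
    obtain ⟨z, _, rfl⟩ := hy
    exact ⟨z, rfl⟩

/-- `C` with the embeddings `β₁`, `β₂` is the free amalgamation of `B₁` and `B₂` over `D` with
respect to `α₁` and `α₂`. (The requirement on functions, that a function vanishes on every tuple
with vertices of both sides, is void as all functions are unary.) -/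
structure IsFreeAmalgam {D : GStr L V} {B₁ : GStr L W} {B₂ : GStr L X} {C : GStr L Y}
    (α₁ : Emb D B₁) (α₂ : Emb D B₂) (β₁ : Emb B₁ C) (β₂ : Emb B₂ C) : Prop where
  comm : β₁.comp α₁ = β₂.comp α₂
  strong : ∀ x₁ x₂, β₁.toHom x₁ = β₂.toHom x₂ →
    x₁ ∈ Set.range α₁.toFun ∧ x₂ ∈ Set.range α₂.toFun
  cover : Set.range β₁.toFun ∪ Set.range β₂.toFun = Set.univ
  free : ∀ {k : ℕ} (R : L.Rel k) (x : Fin (k + 1) → Y),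
    (∃ i, x i ∈ β₁.toFun '' (Set.range α₁.toFun)ᶜ) →
    (∃ j, x j ∈ β₂.toFun '' (Set.range α₂.toFun)ᶜ) → x ∉ C.rel R

/-- A structure is irreducible if it is not the free amalgamation of two proper substructures
(over their intersection, all maps being inclusions). -/
def Irreducible (A : GStr L V) : Prop :=
  ¬ ∃ S T : Substr A, S.carrier ≠ Set.univ ∧ T.carrier ≠ Set.univ ∧
    IsFreeAmalgam ((S.inter T).inclusion S Set.inter_subset_left)
      ((S.inter T).inclusion T Set.inter_subset_right) S.incl T.incl

/-- A homomorphism-embedding: a homomorphism whose restriction to every irreducible substructure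
is an embedding. -/
def Hom.IsHomEmbedding {A : GStr L V} {B : GStr L W} (f : Hom A B) : Prop :=
  ∀ C : Substr A, C.str.Irreducible → (f.comp C.incl.toHom).IsEmbedding

/-- Tree amalgamations of copies of `A`. -/
inductive IsTreeAmalgam {V : Type w} (A : GStr L V) : ∀ {W : Type w}, GStr L W → Prop
  | copy {W : Type w} {D : GStr L W} (f : Hom A D) (hf : f.IsIso) : IsTreeAmalgam A D
  | amalgam {W₁ W₂ X Y : Type w} {B₁ : GStr L W₁} {B₂ : GStr L W₂} {D : GStr L X} {C : GStr L Y}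
      (h₁ : IsTreeAmalgam A B₁) (h₂ : IsTreeAmalgam A B₂)
      (α₁ : Emb A B₁) (α₂ : Emb A B₂) (δ₁ δ₂ : Emb D A) (β₁ : Emb B₁ C) (β₂ : Emb B₂ C)
      (h : IsFreeAmalgam (α₁.comp δ₁) (α₂.comp δ₂) β₁ β₂) : IsTreeAmalgam A C

/-- A partial automorphism: an isomorphism between two (possibly empty) substructures. -/
structure PartialAut (A : GStr L V) where
  dom : Substr A
  ran : Substr A
  map : Hom dom.str ran.str
  isIso : map.IsIso

/-- The triple `(f, g, h)` is coherent: the domains and ranges match and `h = g ∘ f` (on the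
vertices and on the language). -/
structure CoherentTriple {A : GStr L V} (f g h : PartialAut A) : Prop where
  dom_eq : f.dom = h.dom
  mid_eq : f.ran = g.dom
  ran_eq : g.ran = h.ran
  lang_eq : h.map.lang = g.map.lang * f.map.lang
  map_eq : ∀ (x : V) (hf : x ∈ f.dom.carrier) (hg : (f.map ⟨x, hf⟩ : V) ∈ g.dom.carrier)
    (hh : x ∈ h.dom.carrier), (h.map ⟨x, hh⟩ : V) = g.map ⟨f.map ⟨x, hf⟩, hg⟩

/-- The homomorphism `θ` of `B` to itself extends the partial automorphism `f` of a substructure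
`S` of `B` (on the vertices and on the language). -/
def Extends {B : GStr L W} {S : Substr B} (θ : Hom B B) (f : PartialAut S.str) : Prop :=
  θ.lang = f.map.lang ∧ ∀ x : f.dom.carrier, θ (x : S.carrier) = ((f.map x : S.carrier) : W)

/-- The embedding `ψ` witnesses that `B` is an EPPA-witness for `A`: every partial automorphism of
`ψ(A)` extends to an automorphism of `B`. -/
def IsEPPAVia {A : GStr L V} {B : GStr L W} (ψ : Emb A B) : Prop :=
  ∀ f : PartialAut ψ.range.str, ∃ θ : Hom B B, θ.IsIso ∧ Extends θ f

/-- `B` is an EPPA-witness for `A`. -/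
def IsEPPAWitness (A : GStr L V) (B : GStr L W) : Prop :=
  ∃ ψ : Emb A B, IsEPPAVia ψ

/-- The embedding `ψ` witnesses that `B` is a coherent EPPA-witness for `A`: the extensions can be
chosen so that coherent triples are sent to coherent triples. -/
def IsCoherentVia {A : GStr L V} {B : GStr L W} (ψ : Emb A B) : Prop :=
  ∃ φ : PartialAut ψ.range.str → Hom B B,
    (∀ f, (φ f).IsIso ∧ Extends (φ f) f) ∧
    ∀ f g h, CoherentTriple f g h → φ h = (φ g).comp (φ f)

/-- `B` is a coherent EPPA-witness for `A`. -/
def IsCoherentEPPAWitness (A : GStr L V) (B : GStr L W) : Prop :=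
  ∃ ψ : Emb A B, IsCoherentVia ψ

/-- Irreducible structure faithfulness with respect to `ψ(A)`: every irreducible substructure of
`B` is sent into `ψ(A)` by an automorphism of `B`. -/
def IsFaithfulVia {A : GStr L V} {B : GStr L W} (ψ : Emb A B) : Prop :=
  ∀ C : Substr B, C.str.Irreducible →
    ∃ θ : Hom B B, θ.IsIso ∧ θ.toFun '' C.carrier ⊆ Set.range ψ.toFun

end GStr

/-! ### Automorphism groups, closures and stages. -/

namespace GStr

open Equiv

variable {L : PermLang.{u, v}}
variable {V : Type w} {W : Type w₁} {X : Type w₂} {Y : Type w₃}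

/-! Work with a finite structure that has a copy ψ(A) of A and a group G of automorphisms containing
an extension of every partial automorphism of that copy (a `Stage`). The translates of ψ(A) under G
are called blocks, and two vertices are adjacent if some block contains both. The witness B₀ with
its automorphism group is the first stage; B arises from it by finitely many covers, whose
projections send blocks isomorphically to blocks.

A cover (`LocalSystem`) decorates a vertex v with values attached to pairs (y, M), where y is in the
closure of v and M is a relevant vertex set containing y. Values occurring in one block satisfy a
binary constraint. Partial automorphisms lift because, for each M separately, a permutation of the
values takes standard values to standard values; when these permutations are chosen so that they
compose, coherence is kept. A constraint that has no solution on all of M prevents M from lifting to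
the cover with its adjacencies.

Two constraints are used. (a) If no block contains M, distinct vertices must get distinct values out
of |M| - 1. By pigeonhole every clique of the cover then projects into a block, and so lies in a
block itself (`cliqueSystem_conformal`). Irreducible substructures are cliques
(`Covered.adj_of_irreducible`), which gives faithfulness and shows that maps embedding every block
are homomorphism-embeddings. (b) If M is triangle-free and contains a cycle ("twisted"), the values
are vectors over the field with two elements indexed by edges, and adjacent vertices must differ by
the basis vector of their edge. The edges of a cycle have nonzero sum, so M does not lift
(`not_twisted_of_lift`).

A substructure without twisted subsets has a chordal adjacency graph. By Dirac's argument it is a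
clique or splits along a clique (`exists_separation`), so by induction it maps to a tree
amalgamation of copies of A. Now iterate (b). A substructure of the cover either projects
isomorphically as a graph, and then its image has no twisted subset, or its image has a smaller
total of vertices and nonadjacent pairs. So n + n² unwindings suffice for substructures on n
vertices (`exists_unwinding`). -/

theorem onRel_mul (g h : L.Γ) {k : ℕ} (R : L.Rel k) :
    PermLang.onRel (g * h) R = PermLang.onRel g (PermLang.onRel h R) := rfl

theorem onFn_mul (g h : L.Γ) (F : L.Fn) :
    PermLang.onFn (g * h) F = PermLang.onFn g (PermLang.onFn h F) := rfl

@[simp] theorem onRel_one {k : ℕ} (R : L.Rel k) : PermLang.onRel (1 : L.Γ) R = R := rfl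

@[simp] theorem onFn_one (F : L.Fn) : PermLang.onFn (1 : L.Γ) F = F := rfl

@[simp] theorem onRel_inv_onRel (g : L.Γ) {k : ℕ} (R : L.Rel k) :
    PermLang.onRel g⁻¹ (PermLang.onRel g R) = R := by
  rw [← onRel_mul, inv_mul_cancel, onRel_one]

@[simp] theorem onRel_onRel_inv (g : L.Γ) {k : ℕ} (R : L.Rel k) :
    PermLang.onRel g (PermLang.onRel g⁻¹ R) = R := by
  rw [← onRel_mul, mul_inv_cancel, onRel_one]

@[simp] theorem onFn_inv_onFn (g : L.Γ) (F : L.Fn) :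
    PermLang.onFn g⁻¹ (PermLang.onFn g F) = F := by
  rw [← onFn_mul, inv_mul_cancel, onFn_one]

@[simp] theorem onFn_onFn_inv (g : L.Γ) (F : L.Fn) :
    PermLang.onFn g (PermLang.onFn g⁻¹ F) = F := by
  rw [← onFn_mul, mul_inv_cancel, onFn_one]

theorem Hom.ext' {A : GStr L V} {B : GStr L W} {f g : Hom A B} (h₁ : f.lang = g.lang)
    (h₂ : ∀ x, f.toFun x = g.toFun x) : f = g := by
  cases f; cases g
  obtain rfl := h₁
  obtain rfl := funext h₂
  rfl

theorem Emb.ext' {A : GStr L V} {B : GStr L W} {f g : Emb A B} (h₁ : f.lang = g.lang)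
    (h₂ : ∀ x, f.toFun x = g.toFun x) : f = g := by
  have := Hom.ext' (f := f.toHom) (g := g.toHom) h₁ h₂
  cases f; cases g
  obtain rfl := this
  rfl

/-- The automorphisms of a structure, as pairs of a language permutation and a vertex
permutation. -/
def autGroup (B : GStr L W) : Subgroup (L.Γ × Perm W) where
  carrier := {g | (∀ (k : ℕ) (R : L.Rel k) (x : Fin (k + 1) → W),
      x ∈ B.rel R ↔ (fun i => g.2 (x i)) ∈ B.rel (PermLang.onRel g.1 R)) ∧
    ∀ F x, g.2 '' B.fn F x = B.fn (PermLang.onFn g.1 F) (g.2 x)}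
  one_mem' := ⟨fun _ _ _ => Iff.rfl, fun F x => by simp⟩
  mul_mem' := by
    rintro g h ⟨hg₁, hg₂⟩ ⟨hh₁, hh₂⟩
    refine ⟨fun k R x => (hh₁ k R x).trans (hg₁ k _ _), fun F x => ?_⟩
    have := hg₂ (PermLang.onFn h.1 F) (h.2 x)
    rw [← hh₂, Set.image_image] at this
    exact this
  inv_mem' := by
    rintro g ⟨hg₁, hg₂⟩
    refine ⟨fun k R x => ?_, fun F x => ?_⟩
    · have := hg₁ k (PermLang.onRel g⁻¹.1 R) (fun i => g⁻¹.2 (x i))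
      simp only [Prod.fst_inv, Prod.snd_inv, onRel_onRel_inv, Perm.coe_inv, Equiv.apply_symm_apply] at this
      exact this.symm
    · have := hg₂ (PermLang.onFn g⁻¹.1 F) (g⁻¹.2 x)
      simp only [Prod.fst_inv, Prod.snd_inv, onFn_onFn_inv, Perm.coe_inv, Equiv.apply_symm_apply] at this ⊢
      rw [← this, Set.image_image]
      simp

/-- The automorphism given by an element of the automorphism group. -/
def homOfAut {B : GStr L W} (g : L.Γ × Perm W) (hg : g ∈ B.autGroup) : Hom B B where
  lang := g.1
  toFun := g.2
  map_rel := fun R x hx => (hg.1 _ R x).1 hx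
  map_fn := fun F x => (hg.2 F x).subset

theorem homOfAut_isIso {B : GStr L W} (g : L.Γ × Perm W) (hg : g ∈ B.autGroup) :
    (homOfAut g hg).IsIso where
  injective := g.2.injective
  rel_iff := fun R x => hg.1 _ R x
  fn_eq := fun F x => hg.2 F x
  surjective := g.2.surjective

/-- The element of the automorphism group given by an automorphism. -/
noncomputable def autOfHom {B : GStr L W} (f : Hom B B) (hf : f.IsIso) : L.Γ × Perm W :=
  (f.lang, Equiv.ofBijective f.toFun ⟨hf.injective, hf.surjective⟩)

theorem autOfHom_mem {B : GStr L W} (f : Hom B B) (hf : f.IsIso) :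
    autOfHom f hf ∈ B.autGroup :=
  ⟨fun _ R x => hf.rel_iff R x, fun F x => hf.fn_eq F x⟩

/-- The closure of a vertex under the functions. -/
def cl (B : GStr L W) (x : W) : Set W :=
  {y | Relation.ReflTransGen (fun a b => ∃ F, b ∈ B.fn F a) x y}

theorem mem_cl_self (B : GStr L W) (x : W) : x ∈ B.cl x := Relation.ReflTransGen.refl

theorem cl_trans {B : GStr L W} {x y z : W} (h : y ∈ B.cl x) (h' : z ∈ B.cl y) : z ∈ B.cl x :=
  Relation.ReflTransGen.trans h h'

theorem fn_subset_cl {B : GStr L W} {F : L.Fn} {x y : W} (h : y ∈ B.fn F x) : y ∈ B.cl x :=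
  Relation.ReflTransGen.single ⟨F, h⟩

theorem cl_subset_of_closed {B : GStr L W} {S : Set W} (hS : ∀ F, ∀ x ∈ S, B.fn F x ⊆ S)
    {x y : W} (hx : x ∈ S) (h : y ∈ B.cl x) : y ∈ S := by
  induction h with
  | refl => exact hx
  | tail _ h ih => exact hS _ _ ih h.choose_spec

theorem map_mem_cl {B : GStr L W} {g : L.Γ × Perm W} (hg : g ∈ B.autGroup) {x y : W}
    (h : y ∈ B.cl x) : g.2 y ∈ B.cl (g.2 x) := by
  induction h with
  | refl => exact mem_cl_self _ _
  | tail _ h ih =>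
    obtain ⟨F, hF⟩ := h
    refine cl_trans ih (fn_subset_cl (F := PermLang.onFn g.1 F) ?_)
    rw [← hg.2]
    exact ⟨_, hF, rfl⟩

theorem map_mem_cl_iff {B : GStr L W} {g : L.Γ × Perm W} (hg : g ∈ B.autGroup) {x y : W} :
    g.2 y ∈ B.cl (g.2 x) ↔ y ∈ B.cl x := by
  refine ⟨fun h => ?_, map_mem_cl hg⟩
  simpa using map_mem_cl (inv_mem hg) h

/-- A finite structure into which `A` embeds, together with a group `G` of its automorphisms that
contains an extension of every partial automorphism of the image of `A`. The extensions are
coherent under the assumption `c`. -/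
structure Stage (A : GStr L V) (c : Prop) where
  U : Type w
  fin : Finite U
  B : GStr L U
  ψ : Emb A B
  G : Subgroup (L.Γ × Perm U)
  G_le : G ≤ B.autGroup
  φ : PartialAut A → L.Γ × Perm U
  φ_mem : ∀ f, φ f ∈ G
  φ_lang : ∀ f, (φ f).1 = ψ.lang * f.map.lang * ψ.lang⁻¹
  φ_map : ∀ f a (ha : a ∈ f.dom.carrier), (φ f).2 (ψ.toFun a) = ψ.toFun (f.map ⟨a, ha⟩)
  coh : c → ∀ f g h, CoherentTriple f g h → φ h = φ g * φ f

namespace Stage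

variable {A : GStr L V} {c : Prop} (S : Stage A c)

/-- The vertices of the copy of `A` given by `g`. -/
def block (g : L.Γ × Perm S.U) : Set S.U := Set.range fun a => g.2 (S.ψ.toFun a)

/-- Two vertices lie in a common copy of `A`. -/
def Adj (x y : S.U) : Prop := ∃ g ∈ S.G, x ∈ S.block g ∧ y ∈ S.block g

/-- Every vertex and every tuple in a relation lies in a copy of `A`. -/
structure Covered : Prop where
  vertex : ∀ x, ∃ g ∈ S.G, x ∈ S.block g
  rel : ∀ (k : ℕ) (R : L.Rel k) (x : Fin (k + 1) → S.U), x ∈ S.B.rel R →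
    ∃ g ∈ S.G, ∀ i, x i ∈ S.block g

/-- Every clique lies in a copy of `A`. -/
def Conformal : Prop := ∀ C : Set S.U, (∀ x ∈ C, ∀ y ∈ C, S.Adj x y) → ∃ g ∈ S.G, C ⊆ S.block g

variable {S}

theorem Adj.symm {x y : S.U} (h : S.Adj x y) : S.Adj y x := by
  obtain ⟨g, hg, hx, hy⟩ := h
  exact ⟨g, hg, hy, hx⟩

theorem map_mem_block {g h : L.Γ × Perm S.U} {x : S.U} (hx : x ∈ S.block h) :
    g.2 x ∈ S.block (g * h) := by
  obtain ⟨a, rfl⟩ := hx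
  exact ⟨a, rfl⟩

theorem Adj.map {g : L.Γ × Perm S.U} (hg : g ∈ S.G) {x y : S.U} (h : S.Adj x y) :
    S.Adj (g.2 x) (g.2 y) := by
  obtain ⟨k, hk, hx, hy⟩ := h
  exact ⟨g * k, mul_mem hg hk, map_mem_block hx, map_mem_block hy⟩

theorem adj_map_iff {g : L.Γ × Perm S.U} (hg : g ∈ S.G) {x y : S.U} :
    S.Adj (g.2 x) (g.2 y) ↔ S.Adj x y := by
  refine ⟨fun h => ?_, Adj.map hg⟩
  simpa using Adj.map (inv_mem hg) h

/-- The embedding of `A` whose image is the copy given by `g`. -/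
def chart {g : L.Γ × Perm S.U} (hg : g ∈ S.G) : Emb A S.B where
  lang := g.1 * S.ψ.lang
  toFun a := g.2 (S.ψ.toFun a)
  map_rel R x hx := ((S.G_le hg).1 _ _ _).1 (S.ψ.map_rel R x hx)
  map_fn F x := by
    rw [onFn_mul, ← (S.G_le hg).2, ← S.ψ.isEmbedding.fn_eq, Set.image_image]
  isEmbedding :=
    { injective := g.2.injective.comp S.ψ.isEmbedding.injective
      rel_iff := fun R x => (S.ψ.isEmbedding.rel_iff R x).trans ((S.G_le hg).1 _ _ _)
      fn_eq := fun F x => by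
        rw [onFn_mul]
        change _ = S.B.fn _ (g.2 (S.ψ.toFun x))
        rw [← (S.G_le hg).2]
        rw [← S.ψ.isEmbedding.fn_eq, Set.image_image] }

theorem block_closed {g : L.Γ × Perm S.U} (hg : g ∈ S.G) (F : L.Fn) :
    ∀ x ∈ S.block g, S.B.fn F x ⊆ S.block g :=
  fun x hx => (chart hg).range.closed F x hx

theorem cl_subset_block {g : L.Γ × Perm S.U} (hg : g ∈ S.G) {x y : S.U} (hx : x ∈ S.block g)
    (hy : y ∈ S.B.cl x) : y ∈ S.block g :=
  cl_subset_of_closed (block_closed hg) hx hy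

theorem Adj.cl_right {x y z : S.U} (h : S.Adj x y) (hz : z ∈ S.B.cl y) : S.Adj x z := by
  obtain ⟨g, hg, hx, hy⟩ := h
  exact ⟨g, hg, hx, cl_subset_block hg hy hz⟩

theorem Covered.adj_self (hS : S.Covered) (x : S.U) : S.Adj x x := by
  obtain ⟨g, hg, hx⟩ := hS.vertex x
  exact ⟨g, hg, hx, hx⟩

/-- If no block contains both images, the vertices whose closure misses the first image and those
whose closure misses the second form two proper substructures. They cover `E`, and a tuple of a
relation across them would put both images into one block, since blocks are closed under functions.
So `E` would be a free amalgamation. -/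
theorem Covered.adj_of_irreducible (hS : S.Covered) {Z : Type w₁} {E : GStr L Z}
    (hE : E.Irreducible) (e : Emb E S.B) (p q : Z) : S.Adj (e.toFun p) (e.toFun q) := by
  by_contra hxy
  have closed : ∀ z : S.U, ∀ (F : L.Fn) (a : Z), a ∈ {a | z ∉ S.B.cl (e.toFun a)} →
      E.fn F a ⊆ {a | z ∉ S.B.cl (e.toFun a)} :=
    fun z F a ha b hb hz => ha (cl_trans (fn_subset_cl (e.map_fn F a ⟨b, hb, rfl⟩)) hz)
  refine hE ⟨⟨_, closed (e.toFun p)⟩, ⟨_, closed (e.toFun q)⟩, ?_, ?_, ?_⟩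
  · intro h
    have : p ∈ {a | e.toFun p ∉ S.B.cl (e.toFun a)} := h.symm.subset trivial
    exact this (mem_cl_self _ _)
  · intro h
    have : q ∈ {a | e.toFun q ∉ S.B.cl (e.toFun a)} := h.symm.subset trivial
    exact this (mem_cl_self _ _)
  · refine ⟨rfl, ?_, ?_, ?_⟩
    · rintro ⟨a, ha⟩ ⟨b, hb⟩ (h : a = b)
      subst h
      exact ⟨⟨⟨a, ha, hb⟩, rfl⟩, ⟨⟨a, ha, hb⟩, rfl⟩⟩
    · refine Set.eq_univ_of_forall fun a => ?_
      by_cases h₁ : e.toFun p ∈ S.B.cl (e.toFun a)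
      · right
        refine ⟨⟨a, fun h₂ => hxy ?_⟩, rfl⟩
        exact ((hS.adj_self _).cl_right h₂).symm.cl_right h₁ |>.symm
      · exact Or.inl ⟨⟨a, h₁⟩, rfl⟩
    · rintro k R z ⟨i, ⟨a, ha⟩, ha', hi⟩ ⟨j, ⟨b, hb⟩, hb', hj⟩ hz
      obtain ⟨g, hg, h⟩ := hS.rel k _ _ (e.map_rel R z hz)
      have hia : z i = a := hi.symm
      have hjb : z j = b := hj.symm
      have h₁ : e.toFun p ∈ S.B.cl (e.toFun (z j)) := by
        rw [hjb]
        by_contra hb''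
        exact hb' ⟨⟨b, hb'', hb⟩, rfl⟩
      have h₂ : e.toFun q ∈ S.B.cl (e.toFun (z i)) := by
        rw [hia]
        by_contra ha''
        exact ha' ⟨⟨a, ha, ha''⟩, rfl⟩
      exact hxy ⟨g, hg, cl_subset_block hg (h j) h₁, cl_subset_block hg (h i) h₂⟩

theorem Covered.range_subset_block (hS : S.Covered) (hS' : S.Conformal) {Z : Type w₁}
    {E : GStr L Z} (hE : E.Irreducible) (e : Emb E S.B) :
    ∃ g ∈ S.G, Set.range e.toFun ⊆ S.block g := by
  refine hS' _ ?_
  rintro _ ⟨p, rfl⟩ _ ⟨q, rfl⟩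
  exact hS.adj_of_irreducible hE e p q

theorem Covered.isFaithfulVia (hS : S.Covered) (hS' : S.Conformal) : IsFaithfulVia S.ψ := by
  intro C hC
  obtain ⟨g, hg, h⟩ := hS.range_subset_block hS' hC C.incl
  refine ⟨_, homOfAut_isIso g⁻¹ (S.G_le (inv_mem hg)), ?_⟩
  rintro _ ⟨x, hx, rfl⟩
  obtain ⟨a, ha⟩ := h ⟨⟨x, hx⟩, rfl⟩
  have ha' : g.2 (S.ψ.toFun a) = x := ha
  exact ⟨a, by simp [homOfAut, ← ha']⟩

end Stage

end GStr

/-! ### Covers of a stage by decorated vertices. -/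

namespace GStr

open Equiv

variable {L : PermLang.{u, v}} {V : Type w}

/-- A family of valuations on a stage: for every relevant set `M` of vertices, the vertices in `M`
are to be decorated by values in `X` subject to the binary constraint `compat M`. The copy of `A`
carries the standard valuation `std`, and `ext` provides a coherent choice of permutations of the
values which extend partial maps between compatible valuations. -/
structure LocalSystem {A : GStr L V} {c : Prop} (S : Stage A c) where
  X : Type w
  finX : Finite X
  relevant : Set (Set S.U)
  map_relevant : ∀ g ∈ S.G, ∀ M ∈ relevant, g.2 '' M ∈ relevant
  compat : Set S.U → S.U → X → S.U → X → Prop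
  std : Set S.U → S.U → X
  std_compat : ∀ M ∈ relevant, ∀ y ∈ M, ∀ y' ∈ M, y ∈ Set.range S.ψ.toFun →
    y' ∈ Set.range S.ψ.toFun → compat M y (std M y) y' (std M y')
  ext : Perm S.U → Set S.U → Set S.U → (S.U → X) → (S.U → X) → Perm X
  ext_apply : ∀ g ∈ S.G, ∀ M ∈ relevant, ∀ Q ⊆ M, Q ⊆ Set.range S.ψ.toFun → ∀ a b,
    (∀ y ∈ Q, ∀ y' ∈ Q, compat M y (a y) y' (a y')) →
    (∀ y ∈ Q, ∀ y' ∈ Q, compat (g.2 '' M) (g.2 y) (b (g.2 y)) (g.2 y') (b (g.2 y'))) →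
    ∀ y ∈ Q, ext g.2 M Q a b (a y) = b (g.2 y)
  ext_compat : ∀ g ∈ S.G, ∀ M ∈ relevant, ∀ Q ⊆ M, Q ⊆ Set.range S.ψ.toFun → ∀ a b,
    (∀ y ∈ Q, ∀ y' ∈ Q, compat M y (a y) y' (a y')) →
    (∀ y ∈ Q, ∀ y' ∈ Q, compat (g.2 '' M) (g.2 y) (b (g.2 y)) (g.2 y') (b (g.2 y'))) →
    ∀ y u y' u', compat M y u y' u' ↔
      compat (g.2 '' M) (g.2 y) (ext g.2 M Q a b u) (g.2 y') (ext g.2 M Q a b u')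
  ext_comp : ∀ g ∈ S.G, ∀ h ∈ S.G, ∀ M ∈ relevant, ∀ Q ⊆ M, Q ⊆ Set.range S.ψ.toFun → ∀ a b c,
    (∀ y ∈ Q, ∀ y' ∈ Q, compat M y (a y) y' (a y')) →
    (∀ y ∈ Q, ∀ y' ∈ Q, compat (g.2 '' M) (g.2 y) (b (g.2 y)) (g.2 y') (b (g.2 y'))) →
    (∀ y ∈ Q, ∀ y' ∈ Q, compat (h.2 '' (g.2 '' M)) (h.2 (g.2 y)) (c (h.2 (g.2 y)))
      (h.2 (g.2 y')) (c (h.2 (g.2 y')))) →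
    ext (h.2 * g.2) M Q a c = ext h.2 (g.2 '' M) (g.2 '' Q) b c * ext g.2 M Q a b

namespace LocalSystem

variable {A : GStr L V} {c : Prop} {S : Stage A c} (Λ : LocalSystem S)

/-- Decorations: a vertex, a set and a value. -/
abbrev Dec : Type w := S.U × Set S.U × Λ.X

/-- Two decorations for the same relevant set are compatible. -/
def DecCompat (p q : Λ.Dec) : Prop :=
  p.2.1 = q.2.1 ∧ p.2.1 ∈ Λ.relevant ∧ Λ.compat p.2.1 p.1 p.2.2 q.1 q.2.2

/-- The lifts of elements of the group of the stage to permutations of the decorations. -/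
def coverGroup : Subgroup (L.Γ × Perm S.U × Perm Λ.Dec) where
  carrier := {g | (g.1, g.2.1) ∈ S.G ∧ (∀ p, (g.2.2 p).1 = g.2.1 p.1) ∧
    (∀ p, (g.2.2 p).2.1 = g.2.1 '' p.2.1) ∧
    ∀ p q, Λ.DecCompat p q ↔ Λ.DecCompat (g.2.2 p) (g.2.2 q)}
  one_mem' := ⟨one_mem S.G, fun _ => rfl, fun p => (Set.image_id _).symm, fun _ _ => Iff.rfl⟩
  mul_mem' := by
    rintro g h ⟨hg₁, hg₂, hg₃, hg₄⟩ ⟨hh₁, hh₂, hh₃, hh₄⟩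
    refine ⟨mul_mem hg₁ hh₁, fun p => ?_, fun p => ?_, fun p q => ?_⟩
    · exact (hg₂ _).trans (congrArg _ (hh₂ p))
    · refine (hg₃ _).trans ?_
      rw [hh₃, Set.image_image]
      rfl
    · exact (hh₄ p q).trans (hg₄ _ _)
  inv_mem' := by
    rintro g ⟨hg₁, hg₂, hg₃, hg₄⟩
    refine ⟨inv_mem hg₁, fun p => ?_, fun p => ?_, fun p q => ?_⟩
    · have := hg₂ (g⁻¹.2.2 p)
      simp only [Prod.snd_inv, Prod.fst_inv, Perm.coe_inv, Equiv.apply_symm_apply] at this ⊢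
      rw [this, Equiv.symm_apply_apply]
    · have := hg₃ (g⁻¹.2.2 p)
      simp only [Prod.snd_inv, Prod.fst_inv, Perm.coe_inv, Equiv.apply_symm_apply] at this ⊢
      rw [this, Set.image_image]
      simp
    · have := hg₄ (g⁻¹.2.2 p) (g⁻¹.2.2 q)
      simp only [Prod.snd_inv, Perm.coe_inv, Equiv.apply_symm_apply] at this ⊢
      exact this.symm

/-- The standard decorations of the vertices in `Q`. -/
def sec (Q : Set S.U) : Set Λ.Dec :=
  {p | p.1 ∈ Q ∧ p.1 ∈ p.2.1 ∧ p.2.1 ∈ Λ.relevant ∧ p.2.2 = Λ.std p.2.1 p.1}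

/-- The action of the lifts on vertices with a set of decorations. -/
def act (g : L.Γ × Perm S.U × Perm Λ.Dec) (v : S.U × Set Λ.Dec) : S.U × Set Λ.Dec :=
  (g.2.1 v.1, g.2.2 '' v.2)

/-- The vertex of the cover corresponding to `a` in the copy of `A` given by `g`. -/
def vtx (g : L.Γ × Perm S.U × Perm Λ.Dec) (a : V) : S.U × Set Λ.Dec :=
  Λ.act g (S.ψ.toFun a, Λ.sec (S.B.cl (S.ψ.toFun a)))

variable {Λ}

theorem act_mul (g h : L.Γ × Perm S.U × Perm Λ.Dec) (v : S.U × Set Λ.Dec) :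
    Λ.act (g * h) v = Λ.act g (Λ.act h v) := by
  simp only [act, Prod.snd_mul, Prod.fst_mul, Perm.coe_mul, Set.image_comp, Function.comp_apply]

theorem act_one (v : S.U × Set Λ.Dec) : Λ.act 1 v = v := by
  simp [act]

theorem act_vtx (g h : L.Γ × Perm S.U × Perm Λ.Dec) (a : V) :
    Λ.act g (Λ.vtx h a) = Λ.vtx (g * h) a := (act_mul g h _).symm

theorem vtx_injective (g : L.Γ × Perm S.U × Perm Λ.Dec) : Function.Injective (Λ.vtx g) := by
  intro a b h
  exact S.ψ.isEmbedding.injective (g.2.1.injective (congrArg Prod.fst h))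

theorem cl_subset_range {a : V} {y : S.U} (h : y ∈ S.B.cl (S.ψ.toFun a)) :
    y ∈ Set.range S.ψ.toFun :=
  cl_subset_of_closed S.ψ.range.closed ⟨a, rfl⟩ h

theorem mem_relevant_of_map {g : L.Γ × Perm S.U} (hg : g ∈ S.G) {M : Set S.U}
    (h : g.2 '' M ∈ Λ.relevant) : M ∈ Λ.relevant := by
  have := Λ.map_relevant _ (inv_mem hg) _ h
  rw [Set.image_image] at this
  simpa using this

theorem mem_vtx_snd {g : L.Γ × Perm S.U × Perm Λ.Dec} (hg : g ∈ Λ.coverGroup) {a : V}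
    {p : Λ.Dec} (hp : p ∈ (Λ.vtx g a).2) :
    p.1 ∈ S.B.cl (Λ.vtx g a).1 ∧ p.1 ∈ p.2.1 ∧ p.2.1 ∈ Λ.relevant := by
  obtain ⟨q, ⟨h₁, h₂, h₃, h₄⟩, rfl⟩ := hp
  rw [hg.2.1, hg.2.2.1]
  exact ⟨map_mem_cl (S.G_le hg.1) h₁, ⟨_, h₂, rfl⟩, Λ.map_relevant _ hg.1 _ h₃⟩

theorem exists_mem_vtx_snd {g : L.Γ × Perm S.U × Perm Λ.Dec} (hg : g ∈ Λ.coverGroup) {a : V}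
    {y : S.U} (hy : y ∈ S.B.cl (Λ.vtx g a).1) {M : Set S.U} (hM : M ∈ Λ.relevant) (hyM : y ∈ M) :
    ∃ u, (y, M, u) ∈ (Λ.vtx g a).2 := by
  let q : Λ.Dec := (g.2.1.symm y, g.2.1.symm '' M,
    Λ.std (g.2.1.symm '' M) (g.2.1.symm y))
  have hq₁ : (g.2.2 q).1 = y := by rw [hg.2.1]; simp [q]
  have hq₂ : (g.2.2 q).2.1 = M := by
    rw [hg.2.2.1, Set.image_image]
    simp
  refine ⟨(g.2.2 q).2.2, q, ⟨?_, ⟨_, hyM, rfl⟩, Λ.map_relevant _ (inv_mem hg.1) _ hM, rfl⟩, ?_⟩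
  · have := map_mem_cl (inv_mem (S.G_le hg.1)) hy
    simpa [vtx, act] using this
  · exact Prod.ext hq₁ (Prod.ext hq₂ rfl)

/-- Standard decorations are compatible and lifts preserve compatibility. Hence adjacency in the
cover enforces the constraint. -/
theorem decCompat_of_mem {g : L.Γ × Perm S.U × Perm Λ.Dec} (hg : g ∈ Λ.coverGroup) {a b : V}
    {p q : Λ.Dec} (hp : p ∈ (Λ.vtx g a).2) (hq : q ∈ (Λ.vtx g b).2) (h : p.2.1 = q.2.1) :
    Λ.DecCompat p q := by
  obtain ⟨p, ⟨hp₁, hp₂, hp₃, hp₄⟩, rfl⟩ := hp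
  obtain ⟨q, ⟨hq₁, hq₂, hq₃, hq₄⟩, rfl⟩ := hq
  rw [hg.2.2.1, hg.2.2.1] at h
  have h' : p.2.1 = q.2.1 := g.2.1.injective.image_injective h
  rw [← hg.2.2.2]
  refine ⟨h', hp₃, ?_⟩
  rw [hp₄, hq₄, ← h']
  exact Λ.std_compat _ hp₃ _ hp₂ _ (h' ▸ hq₂) (cl_subset_range hp₁) (cl_subset_range hq₁)

theorem eq_of_mem {g : L.Γ × Perm S.U × Perm Λ.Dec} (hg : g ∈ Λ.coverGroup) {a b : V}
    {p q : Λ.Dec} (hp : p ∈ (Λ.vtx g a).2) (hq : q ∈ (Λ.vtx g b).2) (h : p.2.1 = q.2.1)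
    (h₁ : p.1 = q.1) : p = q := by
  obtain ⟨p, ⟨hp₁, hp₂, hp₃, hp₄⟩, rfl⟩ := hp
  obtain ⟨q, ⟨hq₁, hq₂, hq₃, hq₄⟩, rfl⟩ := hq
  rw [hg.2.2.1, hg.2.2.1] at h
  rw [hg.2.1, hg.2.1] at h₁
  have h' : p.2.1 = q.2.1 := g.2.1.injective.image_injective h
  have h₁' : p.1 = q.1 := g.2.1.injective h₁
  have : p = q := Prod.ext h₁' (Prod.ext h' (by rw [hp₄, hq₄, h', h₁']))
  rw [this]

variable (Λ) in
/-- The vertices of the cover. -/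
def CoverVertex : Type w := {v : S.U × Set Λ.Dec // ∃ g ∈ Λ.coverGroup, ∃ a, v = Λ.vtx g a}

variable (Λ) in
/-- The cover of a stage given by a family of valuations. -/
def coverStr : GStr L Λ.CoverVertex where
  rel R := {v | (fun i => (v i).1.1) ∈ S.B.rel R ∧
    ∃ g ∈ Λ.coverGroup, ∀ i, ∃ a, (v i).1 = Λ.vtx g a}
  fn F v := {w | w.1.1 ∈ S.B.fn F v.1.1 ∧ w.1.2 = {p | p ∈ v.1.2 ∧ p.1 ∈ S.B.cl w.1.1}}

/-- This is why a vertex carries the decorations of its whole closure: those of a function value can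
be read off by restriction. -/
theorem vtx_restrict {g : L.Γ × Perm S.U × Perm Λ.Dec} (hg : g ∈ Λ.coverGroup) {a b : V}
    (h : S.ψ.toFun b ∈ S.B.cl (S.ψ.toFun a)) :
    (Λ.vtx g b).2 = {p | p ∈ (Λ.vtx g a).2 ∧ p.1 ∈ S.B.cl (Λ.vtx g b).1} := by
  ext p
  constructor
  · intro hp
    refine ⟨?_, (mem_vtx_snd hg hp).1⟩
    obtain ⟨q, hq, rfl⟩ := hp
    exact ⟨q, ⟨cl_trans h hq.1, hq.2⟩, rfl⟩
  · rintro ⟨⟨q, hq, rfl⟩, h'⟩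
    rw [hg.2.1] at h'
    exact ⟨q, ⟨(map_mem_cl_iff (S.G_le hg.1)).1 h', hq.2⟩, rfl⟩

/-- The decorations of a function value are forced by those of its argument, so the value stays in
every block containing the argument. -/
theorem mem_coverStr_fn {g : L.Γ × Perm S.U × Perm Λ.Dec} (hg : g ∈ Λ.coverGroup) {a : V}
    {v w : Λ.CoverVertex} (hv : v.1 = Λ.vtx g a) (F : L.Fn) :
    w ∈ Λ.coverStr.fn F v ↔
      ∃ b, w.1 = Λ.vtx g b ∧ (Λ.vtx g b).1 ∈ S.B.fn F (Λ.vtx g a).1 := by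
  constructor
  · rintro ⟨h₁, h₂⟩
    rw [hv] at h₁ h₂
    obtain ⟨b, hb⟩ := Stage.block_closed hg.1 F _ ⟨a, rfl⟩ h₁
    have hb' : w.1.1 = (Λ.vtx g b).1 := hb.symm
    refine ⟨b, Prod.ext hb' ?_, hb' ▸ h₁⟩
    rw [h₂, hb', ← vtx_restrict hg]
    rw [← map_mem_cl_iff (S.G_le hg.1)]
    rw [hb'] at h₁
    exact fn_subset_cl h₁
  · rintro ⟨b, hw, h⟩
    refine ⟨?_, ?_⟩
    · rw [hw, hv]
      exact h
    · rw [hw, hv]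
      refine vtx_restrict hg ?_
      rw [← map_mem_cl_iff (S.G_le hg.1)]
      exact fn_subset_cl h

theorem finite_coverVertex : Finite Λ.CoverVertex := by
  have := S.fin
  have := Λ.finX
  exact Subtype.finite

instance : MulAction Λ.coverGroup Λ.CoverVertex where
  smul g v := ⟨Λ.act g.1 v.1, by
    obtain ⟨h, hh, a, hv⟩ := v.2
    exact ⟨g.1 * h, mul_mem g.2 hh, a, by rw [hv, act_vtx]⟩⟩
  one_smul v := Subtype.ext (act_one v.1)
  mul_smul g h v := Subtype.ext (act_mul g.1 h.1 v.1)

variable (Λ) in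
/-- The action of the lifts on the cover. -/
def coverHom : Λ.coverGroup →* L.Γ × Perm Λ.CoverVertex :=
  ((MonoidHom.fst _ _).comp Λ.coverGroup.subtype).prod
    (MulAction.toPermHom Λ.coverGroup Λ.CoverVertex)

theorem coverHom_snd (g : Λ.coverGroup) (v : Λ.CoverVertex) :
    ((Λ.coverHom g).2 v).1 = Λ.act g.1 v.1 := rfl

theorem coverHom_rel (g : Λ.coverGroup) {k : ℕ} {R : L.Rel k} {x : Fin (k + 1) → Λ.CoverVertex}
    (h : x ∈ Λ.coverStr.rel R) :
    (fun i => (Λ.coverHom g).2 (x i)) ∈ Λ.coverStr.rel (PermLang.onRel (Λ.coverHom g).1 R) := by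
  obtain ⟨h₁, h, hh, h₂⟩ := h
  refine ⟨((S.G_le g.2.1).1 _ _ _).1 h₁, g.1 * h, mul_mem g.2 hh, fun i => ?_⟩
  obtain ⟨a, ha⟩ := h₂ i
  exact ⟨a, by rw [coverHom_snd, ha, act_vtx]⟩

theorem coverHom_fn (g : Λ.coverGroup) {F : L.Fn} {v w : Λ.CoverVertex}
    (h : w ∈ Λ.coverStr.fn F v) :
    (Λ.coverHom g).2 w ∈ Λ.coverStr.fn (PermLang.onFn (Λ.coverHom g).1 F)
      ((Λ.coverHom g).2 v) := by
  obtain ⟨k, hk, a, ha⟩ := v.2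
  obtain ⟨b, hb, h'⟩ := (mem_coverStr_fn hk ha F).1 h
  refine (mem_coverStr_fn (mul_mem g.2 hk) (a := a) ?_ _).2 ⟨b, ?_, ?_⟩
  · rw [coverHom_snd, ha, act_vtx]
  · rw [coverHom_snd, hb, act_vtx]
  · rw [← act_vtx, ← act_vtx]
    have := (S.G_le g.2.1).2 F (Λ.vtx k a).1
    exact this.subset ⟨_, h', rfl⟩

theorem coverHom_mem (g : Λ.coverGroup) : Λ.coverHom g ∈ Λ.coverStr.autGroup := by
  refine ⟨fun k R x => ⟨coverHom_rel g, fun h => ?_⟩, fun F v => ?_⟩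
  · have := coverHom_rel g⁻¹ h
    simpa using this
  · ext w
    constructor
    · rintro ⟨z, hz, rfl⟩
      exact coverHom_fn g hz
    · intro h
      have := coverHom_fn g⁻¹ h
      refine ⟨(Λ.coverHom g⁻¹).2 w, by simpa using this, by simp⟩

variable (Λ) in
/-- The copy of `A` in the cover. -/
def coverEmb : Emb A Λ.coverStr where
  lang := S.ψ.lang
  toFun a := ⟨Λ.vtx 1 a, 1, one_mem _, a, rfl⟩
  map_rel R x hx := ⟨S.ψ.map_rel R x hx, 1, one_mem _, fun i => ⟨x i, rfl⟩⟩
  map_fn F x := by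
    rintro _ ⟨y, hy, rfl⟩
    exact (mem_coverStr_fn (one_mem _) rfl _).2 ⟨y, rfl, S.ψ.map_fn F x ⟨y, hy, rfl⟩⟩
  isEmbedding :=
    { injective := fun a b h => vtx_injective 1 (congrArg Subtype.val h)
      rel_iff := fun R x =>
        ⟨fun hx => ⟨S.ψ.map_rel R x hx, 1, one_mem _, fun i => ⟨x i, rfl⟩⟩,
          fun h => (S.ψ.isEmbedding.rel_iff R x).2 h.1⟩
      fn_eq := fun F x => by
        ext w
        refine Iff.trans ?_ (mem_coverStr_fn (one_mem _) rfl _).symm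
        constructor
        · rintro ⟨y, hy, rfl⟩
          exact ⟨y, rfl, S.ψ.map_fn F x ⟨y, hy, rfl⟩⟩
        · rintro ⟨y, hy, h⟩
          have h' : S.ψ.toFun y ∈ S.B.fn (PermLang.onFn S.ψ.lang F) (S.ψ.toFun x) := h
          have e := S.ψ.isEmbedding.fn_eq F x
          rw [← e] at h'
          obtain ⟨z, hz, hzy⟩ := h'
          obtain rfl := S.ψ.isEmbedding.injective hzy
          exact ⟨z, hz, Subtype.ext hy.symm⟩ }

/-- The permutation of the decorations given by a permutation of the vertices and permutations
of the values. -/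
def decPerm (X : Type*) {U : Type*} (θ : Perm U) (σ : Set U → Perm X) : Perm (U × Set U × X) where
  toFun p := (θ p.1, θ '' p.2.1, σ p.2.1 p.2.2)
  invFun p := (θ.symm p.1, θ.symm '' p.2.1, (σ (θ.symm '' p.2.1)).symm p.2.2)
  left_inv p := by
    have : θ.symm '' (θ '' p.2.1) = p.2.1 := by rw [Set.image_image]; simp
    simp [this]
  right_inv p := by
    have : θ '' (θ.symm '' p.2.1) = p.2.1 := by rw [Set.image_image]; simp
    simp [this]

/-- Compatibility only relates decorations with the same `M`, so the permutations `σ M` may be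
chosen independently of each other. -/
theorem decPerm_mem {g : L.Γ × Perm S.U} (hg : g ∈ S.G) (σ : Set S.U → Perm Λ.X)
    (hσ : ∀ M ∈ Λ.relevant, ∀ y u y' u', Λ.compat M y u y' u' ↔
      Λ.compat (g.2 '' M) (g.2 y) (σ M u) (g.2 y') (σ M u')) :
    (g.1, g.2, decPerm Λ.X g.2 σ) ∈ Λ.coverGroup := by
  refine ⟨hg, fun p => rfl, fun p => rfl, fun p q => ?_⟩
  obtain ⟨y, M, u⟩ := p
  obtain ⟨y', M', u'⟩ := q
  constructor
  · rintro ⟨rfl, h₂, h₃⟩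
    exact ⟨rfl, Λ.map_relevant _ hg _ h₂, (hσ _ h₂ _ _ _ _).1 h₃⟩
  · rintro ⟨h₁, h₂, h₃⟩
    obtain rfl : M = M' := g.2.injective.image_injective h₁
    have h₂' := mem_relevant_of_map hg h₂
    exact ⟨rfl, h₂', (hσ _ h₂' _ _ _ _).2 h₃⟩

/-- The set of images of the domain of a partial automorphism in a relevant set. -/
def support (S : Stage A c) (f : PartialAut A) (M : Set S.U) : Set S.U :=
  S.ψ.toFun '' f.dom.carrier ∩ M

variable (Λ) in
/-- The permutations of values used to lift the extension of a partial automorphism. -/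
def liftVal (f : PartialAut A) (M : Set S.U) : Perm Λ.X :=
  Λ.ext (S.φ f).2 M (support S f M) (Λ.std M) (Λ.std ((S.φ f).2 '' M))

theorem support_subset (f : PartialAut A) (M : Set S.U) : support S f M ⊆ M :=
  Set.inter_subset_right

theorem support_subset_range (f : PartialAut A) (M : Set S.U) :
    support S f M ⊆ Set.range S.ψ.toFun :=
  fun _ hx => Set.image_subset_range _ _ hx.1

theorem image_support (f : PartialAut A) (M : Set S.U) :
    (S.φ f).2 '' support S f M = S.ψ.toFun '' f.ran.carrier ∩ (S.φ f).2 '' M := by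
  rw [support, Set.image_inter (S.φ f).2.injective]
  congr 1
  ext y
  constructor
  · rintro ⟨_, ⟨a, ha, rfl⟩, rfl⟩
    rw [S.φ_map f a ha]
    exact ⟨_, (f.map ⟨a, ha⟩).2, rfl⟩
  · rintro ⟨b, hb, rfl⟩
    obtain ⟨⟨a, ha⟩, h⟩ := f.isIso.surjective ⟨b, hb⟩
    refine ⟨_, ⟨a, ha, rfl⟩, ?_⟩
    rw [S.φ_map f a ha]
    exact congrArg (fun z => S.ψ.toFun z.1) h

theorem std_compat_of_subset {M : Set S.U} (hM : M ∈ Λ.relevant) {Q : Set S.U} (h₁ : Q ⊆ M)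
    (h₂ : Q ⊆ Set.range S.ψ.toFun) :
    ∀ y ∈ Q, ∀ y' ∈ Q, Λ.compat M y (Λ.std M y) y' (Λ.std M y') :=
  fun _ hy _ hy' => Λ.std_compat M hM _ (h₁ hy) _ (h₁ hy') (h₂ hy) (h₂ hy')

theorem std_compat_image (f : PartialAut A) {M : Set S.U} (hM : M ∈ Λ.relevant) :
    ∀ y ∈ support S f M, ∀ y' ∈ support S f M,
      Λ.compat ((S.φ f).2 '' M) ((S.φ f).2 y) (Λ.std ((S.φ f).2 '' M) ((S.φ f).2 y))
        ((S.φ f).2 y') (Λ.std ((S.φ f).2 '' M) ((S.φ f).2 y')) := by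
  have h := image_support f M
  intro y hy y' hy'
  refine std_compat_of_subset (Λ.map_relevant _ (S.φ_mem f) _ hM)
    (Q := (S.φ f).2 '' support S f M) ?_ ?_ _ ⟨y, hy, rfl⟩ _ ⟨y', hy', rfl⟩
  · exact Set.image_mono (support_subset f M)
  · rw [h]
    exact fun _ hx => Set.image_subset_range _ _ hx.1

theorem liftVal_std (f : PartialAut A) {M : Set S.U} (hM : M ∈ Λ.relevant) {a : V}
    (ha : a ∈ f.dom.carrier) (haM : S.ψ.toFun a ∈ M) :
    Λ.liftVal f M (Λ.std M (S.ψ.toFun a)) =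
      Λ.std ((S.φ f).2 '' M) ((S.φ f).2 (S.ψ.toFun a)) :=
  Λ.ext_apply _ (S.φ_mem f) _ hM _ (support_subset f M) (support_subset_range f M) _ _
    (std_compat_of_subset hM (support_subset f M) (support_subset_range f M))
    (std_compat_image f hM) _ ⟨⟨a, ha, rfl⟩, haM⟩

open Classical in
variable (Λ) in
/-- The lift of the extension of a partial automorphism to the decorations. -/
noncomputable def lift (f : PartialAut A) : L.Γ × Perm S.U × Perm Λ.Dec :=
  ((S.φ f).1, (S.φ f).2,
    decPerm Λ.X (S.φ f).2 fun M => if M ∈ Λ.relevant then Λ.liftVal f M else 1)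

theorem lift_mem (f : PartialAut A) : Λ.lift f ∈ Λ.coverGroup := by
  refine decPerm_mem (S.φ_mem f) _ fun M hM => ?_
  rw [if_pos hM]
  exact Λ.ext_compat _ (S.φ_mem f) _ hM _ (support_subset f M) (support_subset_range f M) _ _
    (std_compat_of_subset hM (support_subset f M) (support_subset_range f M))
    (std_compat_image f hM)

/-- The domain of `f` is closed under functions, so every vertex decorated at `a` comes from the
domain, where `liftVal` takes standard values to standard values. -/
theorem act_lift (f : PartialAut A) {a : V} (ha : a ∈ f.dom.carrier) :
    Λ.act (Λ.lift f) (Λ.vtx 1 a) = Λ.vtx 1 (f.map ⟨a, ha⟩) := by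
  have hf := S.G_le (S.φ_mem f)
  have key : ∀ y ∈ S.B.cl (S.ψ.toFun a), ∃ b ∈ f.dom.carrier, S.ψ.toFun b = y := by
    intro y hy
    refine cl_subset_of_closed (S := S.ψ.toFun '' f.dom.carrier) ?_ ⟨a, ha, rfl⟩ hy
    rintro F _ ⟨b, hb, rfl⟩ z hz
    have h := S.ψ.isEmbedding.fn_eq (PermLang.onFn S.ψ.lang⁻¹ F) b
    rw [onFn_onFn_inv] at h
    rw [← h] at hz
    obtain ⟨d, hd, rfl⟩ := hz
    exact ⟨d, f.dom.closed _ _ hb hd, rfl⟩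
  rw [vtx, act_one, vtx, act_one, ← S.φ_map f a ha]
  refine Prod.ext rfl ?_
  ext p
  constructor
  · rintro ⟨⟨y, M, u⟩, ⟨h₁, h₂, h₃, h₄⟩, rfl⟩
    obtain ⟨b, hb, rfl⟩ := key _ h₁
    refine ⟨map_mem_cl hf h₁, ⟨_, h₂, rfl⟩, Λ.map_relevant _ (S.φ_mem f) _ h₃, ?_⟩
    dsimp only at h₁ h₂ h₃ h₄
    simp only [lift, decPerm, Equiv.coe_fn_mk, if_pos h₃, h₄]
    exact liftVal_std f h₃ hb h₂
  · rintro ⟨h₁, h₂, h₃, h₄⟩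
    obtain ⟨q, rfl⟩ := (Λ.lift f).2.2.surjective p
    obtain ⟨y, M, u⟩ := q
    have h₁' : y ∈ S.B.cl (S.ψ.toFun a) := (map_mem_cl_iff hf).1 h₁
    have h₂' : y ∈ M := (S.φ f).2.injective.mem_set_image.1 h₂
    have h₃' : M ∈ Λ.relevant := mem_relevant_of_map (S.φ_mem f) h₃
    refine ⟨_, ⟨h₁', h₂', h₃', ?_⟩, rfl⟩
    obtain ⟨b, hb, rfl⟩ := key _ h₁'
    simp only [lift, decPerm, Equiv.coe_fn_mk, if_pos h₃'] at h₄
    rw [← liftVal_std f h₃' hb h₂'] at h₄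
    exact (Λ.liftVal f M).injective h₄

open Classical in
-- Since the domain of `g` is the range of `f`, the support of `g` at the image of `M` is the image
-- of the support of `f` at `M`, as `ext_comp` requires. Off the relevant sets all permutations are
-- the identity.
theorem lift_comp (hc : c) {f g h : PartialAut A} (H : CoherentTriple f g h) :
    Λ.lift h = Λ.lift g * Λ.lift f := by
  have e : S.φ h = S.φ g * S.φ f := S.coh hc f g h H
  have e₂ : (S.φ h).2 = (S.φ g).2 * (S.φ f).2 := congrArg Prod.snd e
  have e₁ : (S.φ h).1 = (S.φ g).1 * (S.φ f).1 := congrArg Prod.fst e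
  refine Prod.ext e₁ (Prod.ext e₂ ?_)
  refine Equiv.ext fun p => ?_
  obtain ⟨y, M, u⟩ := p
  have e₃ : (S.φ h).2 '' M = (S.φ g).2 '' ((S.φ f).2 '' M) := by
    rw [e₂, Set.image_image]
    rfl
  refine Prod.ext (congrArg (fun k : Perm S.U => k y) e₂) (Prod.ext e₃ ?_)
  change (if M ∈ Λ.relevant then Λ.liftVal h M else 1 : Perm Λ.X) u =
    (if (S.φ f).2 '' M ∈ Λ.relevant then Λ.liftVal g ((S.φ f).2 '' M) else 1 : Perm Λ.X)
      ((if M ∈ Λ.relevant then Λ.liftVal f M else 1 : Perm Λ.X) u)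
  by_cases hM : M ∈ Λ.relevant
  · have hM' := Λ.map_relevant _ (S.φ_mem f) _ hM
    rw [if_pos hM, if_pos hM, if_pos hM']
    have es : support S h M = support S f M := by rw [support, support, H.dom_eq]
    have eg : support S g ((S.φ f).2 '' M) = (S.φ f).2 '' support S f M := by
      rw [image_support, H.mid_eq, support]
    have := Λ.ext_comp _ (S.φ_mem f) _ (S.φ_mem g) M hM _ (support_subset f M)
      (support_subset_range f M) (Λ.std M) (Λ.std ((S.φ f).2 '' M))
      (Λ.std ((S.φ g).2 '' ((S.φ f).2 '' M)))
      (std_compat_of_subset hM (support_subset f M) (support_subset_range f M))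
      (std_compat_image f hM) fun y hy y' hy' =>
        std_compat_image g hM' _ (eg ▸ ⟨y, hy, rfl⟩) _ (eg ▸ ⟨y', hy', rfl⟩)
    rw [liftVal, liftVal, liftVal, es, e₃, e₂, this, eg]
    rfl
  · have hM' : (S.φ f).2 '' M ∉ Λ.relevant := fun h' => hM (mem_relevant_of_map (S.φ_mem f) h')
    rw [if_neg hM, if_neg hM, if_neg hM']
    rfl

variable (Λ) in
/-- The stage given by the cover. -/
noncomputable def cover : Stage A c where
  U := Λ.CoverVertex
  fin := finite_coverVertex
  B := Λ.coverStr
  ψ := Λ.coverEmb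
  G := Λ.coverHom.range
  G_le := by
    rintro _ ⟨g, rfl⟩
    exact coverHom_mem g
  φ f := Λ.coverHom ⟨Λ.lift f, lift_mem f⟩
  φ_mem f := ⟨_, rfl⟩
  φ_lang f := S.φ_lang f
  φ_map f a ha := Subtype.ext (act_lift f ha)
  coh hc f g h H := by
    rw [← map_mul]
    exact congrArg _ (Subtype.ext (lift_comp hc H))

theorem mem_cover_block (g : Λ.coverGroup) (v : Λ.CoverVertex) :
    v ∈ Λ.cover.block (Λ.coverHom g) ↔ ∃ a, v.1 = Λ.vtx g.1 a := by
  have : ∀ a, ((Λ.coverHom g).2 (Λ.coverEmb.toFun a)).1 = Λ.vtx g.1 a := fun a => by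
    rw [coverHom_snd]
    exact (act_vtx _ _ _).trans (by rw [mul_one])
  constructor
  · rintro ⟨a, rfl⟩
    exact ⟨a, this a⟩
  · rintro ⟨a, ha⟩
    exact ⟨a, Subtype.ext ((this a).trans ha.symm)⟩

/-- The cover keeps only vertices and tuples that lie in blocks, so this holds whatever the stage
`S` is. -/
theorem cover_covered : Λ.cover.Covered where
  vertex v := by
    obtain ⟨g, hg, a, ha⟩ := v.2
    exact ⟨_, ⟨⟨g, hg⟩, rfl⟩, (mem_cover_block _ _).2 ⟨a, ha⟩⟩
  rel k R x hx := by
    obtain ⟨_, g, hg, h⟩ := hx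
    exact ⟨_, ⟨⟨g, hg⟩, rfl⟩, fun i => (mem_cover_block _ _).2 (h i)⟩

theorem cover_adj_iff {v w : Λ.CoverVertex} : Λ.cover.Adj v w ↔
    ∃ g ∈ Λ.coverGroup, (∃ a, v.1 = Λ.vtx g a) ∧ ∃ b, w.1 = Λ.vtx g b := by
  constructor
  · rintro ⟨_, ⟨g, rfl⟩, h₁, h₂⟩
    exact ⟨g.1, g.2, (mem_cover_block _ _).1 h₁, (mem_cover_block _ _).1 h₂⟩
  · rintro ⟨g, hg, h₁, h₂⟩
    exact ⟨_, ⟨⟨g, hg⟩, rfl⟩, (mem_cover_block ⟨g, hg⟩ _).2 h₁, (mem_cover_block ⟨g, hg⟩ _).2 h₂⟩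

end LocalSystem

end GStr

/-! ### Projections between stages and a criterion for conformality. -/

namespace GStr

open Equiv

variable {L : PermLang.{u, v}} {V : Type w}

namespace Stage

variable {A : GStr L V} {c : Prop}

/-- A map between stages that maps copies of `A` to copies of `A`. -/
structure IsProj (T S : Stage A c) (p : T.U → S.U) : Prop where
  lang_eq : T.ψ.lang = S.ψ.lang
  block : ∀ g ∈ T.G, ∃ h ∈ S.G, g.1 = h.1 ∧ ∀ a, p (g.2 (T.ψ.toFun a)) = h.2 (S.ψ.toFun a)

end Stage

namespace LocalSystem

variable {A : GStr L V} {c : Prop} {S : Stage A c} {Λ : LocalSystem S}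

theorem cover_isProj : Λ.cover.IsProj S (fun v : Λ.CoverVertex => v.1.1) where
  lang_eq := rfl
  block := by
    rintro _ ⟨g, rfl⟩
    refine ⟨(g.1.1, g.1.2.1), g.2.1, rfl, fun a => ?_⟩
    rfl

/-- A cover is conformal if the projections of cliques, closed under functions, lie in copies
of `A`. -/
theorem cover_conformal
    (H : ∀ C : Set Λ.CoverVertex, (∀ v ∈ C, ∀ w ∈ C, Λ.cover.Adj v w) →
      ∃ g ∈ S.G, ∀ v ∈ C, S.B.cl v.1.1 ⊆ S.block g) : Λ.cover.Conformal := by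
  classical
  intro C hC
  obtain ⟨g, hg, hgC⟩ := H C hC
  -- Any two vertices of `C` share a block, so their decorations are compatible and agree where they
  -- overlap.
  have uniq : ∀ v ∈ C, ∀ w ∈ C, ∀ p ∈ v.1.2, ∀ q ∈ w.1.2, p.2.1 = q.2.1 →
      Λ.DecCompat p q ∧ (p.1 = q.1 → p = q) := by
    intro v hv w hw p hp q hq h
    obtain ⟨k, hk, ⟨a, ha⟩, b, hb⟩ := cover_adj_iff.1 (hC v hv w hw)
    rw [ha] at hp
    rw [hb] at hq
    exact ⟨decCompat_of_mem hk hp hq h, eq_of_mem hk hp hq h⟩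
  -- The decorations of `C` therefore form one valuation for each `M`; `Λ.std` is only a filler
  -- where `C` carries no decoration.
  let b : Set S.U → S.U → Λ.X := fun M y =>
    if h : ∃ u, ∃ v ∈ C, (y, M, u) ∈ v.1.2 then h.choose else Λ.std M y
  have hb : ∀ v ∈ C, ∀ p ∈ v.1.2, b p.2.1 p.1 = p.2.2 := by
    intro v hv p hp
    have h : ∃ u, ∃ v ∈ C, (p.1, p.2.1, u) ∈ v.1.2 := ⟨_, v, hv, hp⟩
    obtain ⟨w, hw, hw'⟩ := h.choose_spec
    have := (uniq w hw v hv _ hw' p hp rfl).2 rfl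
    simp only [b, dif_pos h]
    exact congrArg (fun q : Λ.Dec => q.2.2) this
  have hbm : ∀ v ∈ C, ∀ y ∈ S.B.cl v.1.1, ∀ M ∈ Λ.relevant, y ∈ M → (y, M, b M y) ∈ v.1.2 := by
    intro v hv y hy M hM hyM
    obtain ⟨k, hk, a, ha⟩ := v.2
    rw [ha] at hy
    obtain ⟨u, hu⟩ := exists_mem_vtx_snd hk hy hM hyM
    rw [← ha] at hu
    have := hb v hv _ hu
    dsimp only at this
    rwa [this]
  let Q : Set S.U := {y | ∃ v ∈ C, g.2 y ∈ S.B.cl v.1.1}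
  have hQr : Q ⊆ Set.range S.ψ.toFun := by
    rintro y ⟨v, hv, hy⟩
    obtain ⟨a, ha⟩ := hgC v hv hy
    exact ⟨a, g.2.injective ha⟩
  have compat₁ : ∀ M ∈ Λ.relevant, ∀ y ∈ Q ∩ M, ∀ y' ∈ Q ∩ M,
      Λ.compat M y (Λ.std M y) y' (Λ.std M y') := fun M hM =>
    std_compat_of_subset hM Set.inter_subset_right (Set.inter_subset_left.trans hQr)
  have compat₂ : ∀ M ∈ Λ.relevant, ∀ y ∈ Q ∩ M, ∀ y' ∈ Q ∩ M,
      Λ.compat (g.2 '' M) (g.2 y) (b (g.2 '' M) (g.2 y)) (g.2 y') (b (g.2 '' M) (g.2 y')) := by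
    rintro M hM y ⟨⟨v, hv, hy⟩, hyM⟩ y' ⟨⟨w, hw, hy'⟩, hyM'⟩
    have hM' := Λ.map_relevant _ hg _ hM
    exact (uniq v hv w hw _ (hbm v hv _ hy _ hM' ⟨y, hyM, rfl⟩) _
      (hbm w hw _ hy' _ hM' ⟨y', hyM', rfl⟩) rfl).1.2.2
  -- On the preimage `Q` of the closures, standard values are moved to those of `b`. Together the `σ
  -- M` give a lift of `g` whose block contains `C`.
  let σ : Set S.U → Perm Λ.X := fun M =>
    if M ∈ Λ.relevant then Λ.ext g.2 M (Q ∩ M) (Λ.std M) (b (g.2 '' M)) else 1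
  have hσ : (g.1, g.2, decPerm Λ.X g.2 σ) ∈ Λ.coverGroup := by
    refine decPerm_mem hg _ fun M hM => ?_
    simp only [σ, if_pos hM]
    exact Λ.ext_compat _ hg _ hM _ Set.inter_subset_right (Set.inter_subset_left.trans hQr) _ _
      (compat₁ M hM) (compat₂ M hM)
  have hσb : ∀ M ∈ Λ.relevant, ∀ y ∈ Q ∩ M, σ M (Λ.std M y) = b (g.2 '' M) (g.2 y) := by
    intro M hM y hy
    simp only [σ, if_pos hM]
    exact Λ.ext_apply _ hg _ hM _ Set.inter_subset_right (Set.inter_subset_left.trans hQr) _ _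
      (compat₁ M hM) (compat₂ M hM) y hy
  refine ⟨_, ⟨⟨_, hσ⟩, rfl⟩, fun v hv => (mem_cover_block _ _).2 ?_⟩
  obtain ⟨a, ha⟩ := hgC v hv (mem_cl_self _ _)
  have ha' : g.2 (S.ψ.toFun a) = v.1.1 := ha
  refine ⟨a, Prod.ext ha'.symm ?_⟩
  obtain ⟨k, hk, d, hd⟩ := v.2
  ext p
  constructor
  · intro hp
    have hp' := hp
    rw [hd] at hp'
    obtain ⟨h₁, h₂, h₃⟩ := mem_vtx_snd hk hp'
    rw [← hd] at h₁
    have hpb := hb v hv p hp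
    obtain ⟨q, rfl⟩ := (decPerm Λ.X g.2 σ).surjective p
    obtain ⟨y, M, u⟩ := q
    have h₁' : g.2 y ∈ S.B.cl v.1.1 := h₁
    have h₂' : y ∈ M := g.2.injective.mem_set_image.1 h₂
    have h₃' : M ∈ Λ.relevant := mem_relevant_of_map hg h₃
    refine ⟨(y, M, u), ⟨?_, h₂', h₃', ?_⟩, rfl⟩
    · rw [← ha', map_mem_cl_iff (S.G_le hg)] at h₁'
      exact h₁'
    · have e : b (g.2 '' M) (g.2 y) = σ M u := hpb
      rw [← hσb M h₃' y ⟨⟨v, hv, h₁'⟩, h₂'⟩] at e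
      exact ((σ M).injective e).symm
  · rintro ⟨⟨y, M, u⟩, ⟨h₁, h₂, h₃, h₄⟩, rfl⟩
    dsimp only at h₁ h₂ h₃ h₄
    have h₁' : g.2 y ∈ S.B.cl v.1.1 := by
      rw [← ha', map_mem_cl_iff (S.G_le hg)]
      exact h₁
    have := hbm v hv _ h₁' _ (Λ.map_relevant _ hg _ h₃) ⟨y, h₂, rfl⟩
    rw [← hσb M h₃ y ⟨⟨v, hv, h₁'⟩, h₂⟩, ← h₄] at this
    exact this

end LocalSystem

end GStr

/-! ### Canonical permutations extending partial injections. -/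

namespace GStr

open Equiv

section Recolor

variable {X ι : Type*}

theorem exists_rank [Finite X] (κ : X → ι) : ∃ r : X → ℕ,
    (∀ i n, (∃ u, κ u = i ∧ r u = n) ↔ n < {u | κ u = i}.ncard) ∧
    ∀ u v, κ u = κ v → r u = r v → u = v := by
  let e : ∀ i, {u | κ u = i} ≃ Fin {u | κ u = i}.ncard := fun i => Finite.equivFinOfCardEq rfl
  refine ⟨fun u => e (κ u) ⟨u, rfl⟩, fun i n => ⟨?_, fun h => ?_⟩, ?_⟩
  · rintro ⟨u, rfl, rfl⟩
    exact (e (κ u) ⟨u, rfl⟩).2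
  · obtain ⟨⟨u, hu⟩, h'⟩ := (e i).surjective ⟨n, h⟩
    obtain rfl := hu
    exact ⟨u, rfl, congrArg Fin.val h'⟩
  · intro u v h h'
    have key : ∀ i (hu : κ u = i) (hv : κ v = i),
        (e i ⟨u, hu⟩ : ℕ) = e i ⟨v, hv⟩ → u = v := fun i hu hv h =>
      congrArg Subtype.val ((e i).injective (Fin.ext h))
    have key' : ∀ i (hu : κ u = i), (e i ⟨u, hu⟩ : ℕ) = e (κ u) ⟨u, rfl⟩ := by
      rintro _ rfl
      rfl
    exact key (κ v) h rfl ((key' _ h).trans h')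

/-- A numbering of every colour class. -/
noncomputable def rank [Finite X] (κ : X → ι) : X → ℕ := (exists_rank κ).choose

theorem rank_lt_iff [Finite X] (κ : X → ι) (i : ι) (n : ℕ) :
    (∃ u, κ u = i ∧ rank κ u = n) ↔ n < {u | κ u = i}.ncard :=
  (exists_rank κ).choose_spec.1 i n

theorem rank_inj [Finite X] {κ : X → ι} {u v : X} (h : κ u = κ v) (h' : rank κ u = rank κ v) : u = v :=
  (exists_rank κ).choose_spec.2 u v h h'

/-- A permutation that maps the colour classes of `κ` to those of `κ'` as prescribed by `π`
and respects the numbering of the classes. -/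
def IsRecolor [Finite X] (κ κ' : X → ι) (π : Perm ι) (σ : Perm X) : Prop :=
  ∀ u, κ' (σ u) = π (κ u) ∧ rank κ' (σ u) = rank κ u

theorem exists_isRecolor [Finite X] {κ κ' : X → ι} {π : Perm ι}
    (h : ∀ i, {u | κ u = i}.ncard = {u | κ' u = π i}.ncard) : ∃ σ, IsRecolor κ κ' π σ := by
  have : ∀ u, ∃ v, κ' v = π (κ u) ∧ rank κ' v = rank κ u := fun u => by
    rw [rank_lt_iff, ← h, ← rank_lt_iff]
    exact ⟨u, rfl, rfl⟩
  choose σ hσ using this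
  have inj : Function.Injective σ := by
    intro u v huv
    refine rank_inj (κ := κ) (π.injective ?_) ?_
    · rw [← (hσ u).1, ← (hσ v).1, huv]
    · rw [← (hσ u).2, ← (hσ v).2, huv]
  exact ⟨Equiv.ofBijective σ (Finite.injective_iff_bijective.1 inj), hσ⟩

/-- Colour and rank determine an element. This uniqueness is what makes the canonical choices
compose, and so the source of coherence. -/
theorem IsRecolor.unique [Finite X] {κ κ' : X → ι} {π : Perm ι} {σ τ : Perm X} (h₁ : IsRecolor κ κ' π σ)
    (h₂ : IsRecolor κ κ' π τ) : σ = τ :=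
  Equiv.ext fun u => rank_inj ((h₁ u).1.trans (h₂ u).1.symm) ((h₁ u).2.trans (h₂ u).2.symm)

theorem IsRecolor.comp [Finite X] {κ κ' κ'' : X → ι} {π π' : Perm ι} {σ τ : Perm X}
    (h₁ : IsRecolor κ κ' π σ) (h₂ : IsRecolor κ' κ'' π' τ) :
    IsRecolor κ κ'' (π' * π) (τ * σ) := fun u =>
  ⟨(h₂ _).1.trans (congrArg π' (h₁ u).1), (h₂ _).2.trans (h₁ u).2⟩

open Classical in
/-- The canonical recolouring, if there is one. -/
noncomputable def recolor [Finite X] (κ κ' : X → ι) (π : Perm ι) : Perm X :=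
  if h : ∃ σ, IsRecolor κ κ' π σ then h.choose else 1

theorem recolor_spec [Finite X] {κ κ' : X → ι} {π : Perm ι}
    (h : ∀ i, {u | κ u = i}.ncard = {u | κ' u = π i}.ncard) :
    IsRecolor κ κ' π (recolor κ κ' π) := by
  have := exists_isRecolor h
  rw [recolor, dif_pos this]
  exact this.choose_spec

open Classical in
/-- The colouring of the values given by an injective valuation `a` of `Q` with values in `T`. -/
noncomputable def valColor {U : Type*} (T : Set X) (Q : Set U) (a : U → X) (u : X) : U ⊕ Prop :=
  if h : ∃ y ∈ Q, a y = u then Sum.inl h.choose else Sum.inr (u ∈ T)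

variable {U : Type*} {T : Set X} {Q : Set U} {a : U → X}

theorem valColor_apply (ha : Set.InjOn a Q) {y : U} (hy : y ∈ Q) :
    valColor T Q a (a y) = Sum.inl y := by
  have h : ∃ z ∈ Q, a z = a y := ⟨y, hy, rfl⟩
  rw [valColor, dif_pos h, ha h.choose_spec.1 hy h.choose_spec.2]

theorem valColor_eq_inl (ha : Set.InjOn a Q) {y : U} {u : X} :
    valColor T Q a u = Sum.inl y ↔ y ∈ Q ∧ a y = u := by
  refine ⟨fun h => ?_, ?_⟩
  · by_cases h' : ∃ y ∈ Q, a y = u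
    · rw [valColor, dif_pos h'] at h
      obtain rfl := Sum.inl.inj h
      exact h'.choose_spec
    · rw [valColor, dif_neg h'] at h
      cases h
  · rintro ⟨hy, rfl⟩
    exact valColor_apply ha hy

theorem valColor_eq_inr {q : Prop} {u : X} :
    valColor T Q a u = Sum.inr q ↔ u ∉ a '' Q ∧ (u ∈ T) = q := by
  by_cases h' : ∃ y ∈ Q, a y = u
  · rw [valColor, dif_pos h']
    simp only [reduceCtorEq, false_iff, not_and]
    exact fun h => (h h').elim
  · rw [valColor, dif_neg h']
    simp only [Sum.inr.injEq]
    exact ⟨fun h => ⟨h', h⟩, fun h => h.2⟩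

/-- The nonempty classes are the singletons of the values of `a` on `Q` and possibly `T \ a '' Q`
and `Tᶜ`, whose sizes depend only on those of `T`, `Q` and `X`. -/
theorem ncard_valColor_fiber [Finite X] {T' : Set X} {b : U → X} (θ : Perm U) (ha : Set.InjOn a Q)
    (haT : Set.MapsTo a Q T) (hb : Set.InjOn b (θ '' Q)) (hbT : Set.MapsTo b (θ '' Q) T')
    (hT : T.ncard = T'.ncard) (i : U ⊕ Prop) :
    {u | valColor T Q a u = i}.ncard =
      {u | valColor T' (θ '' Q) b u = Equiv.sumCongr θ (Equiv.refl Prop) i}.ncard := by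
  have hQ : (a '' Q).ncard = (b '' (θ '' Q)).ncard := by
    rw [ha.ncard_image, hb.ncard_image,
      Set.ncard_image_of_injective _ θ.injective]
  rcases i with y | q
  · simp only [Equiv.sumCongr_apply, Sum.map_inl, valColor_eq_inl ha, valColor_eq_inl hb,
      θ.injective.mem_set_image]
    by_cases hy : y ∈ Q
    · simp [hy]
    · simp [hy]
  · simp only [Equiv.sumCongr_apply, Sum.map_inr, Equiv.refl_apply, valColor_eq_inr]
    by_cases hq : q
    · have e₁ : {u | u ∉ a '' Q ∧ (u ∈ T) = q} = T \ a '' Q := by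
        ext u
        simp [hq, and_comm]
      have e₂ : {u | u ∉ b '' (θ '' Q) ∧ (u ∈ T') = q} = T' \ b '' (θ '' Q) := by
        ext u
        simp [hq, and_comm]
      rw [e₁, e₂, Set.ncard_sdiff haT.image_subset (Set.toFinite _),
        Set.ncard_sdiff hbT.image_subset (Set.toFinite _), hT, hQ]
    · have e₁ : {u | u ∉ a '' Q ∧ (u ∈ T) = q} = Tᶜ := by
        ext u
        simp only [hq, eq_iff_iff, iff_false, Set.mem_ofPred_eq, Set.mem_compl_iff]
        exact ⟨fun h => h.2, fun h => ⟨fun h' => h (haT.image_subset h'), h⟩⟩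
      have e₂ : {u | u ∉ b '' (θ '' Q) ∧ (u ∈ T') = q} = T'ᶜ := by
        ext u
        simp only [hq, eq_iff_iff, iff_false, Set.mem_ofPred_eq, Set.mem_compl_iff]
        exact ⟨fun h => h.2, fun h => ⟨fun h' => h (hbT.image_subset h'), h⟩⟩
      rw [e₁, e₂, Set.ncard_compl T (Set.toFinite _), Set.ncard_compl T' (Set.toFinite _), hT]

/-- A coherent choice of permutations extending partial injections. -/
noncomputable def valExt [Finite X] (T T' : Set X) (θ : Perm U) (Q : Set U) (a b : U → X) : Perm X :=
  recolor (valColor T Q a) (valColor T' (θ '' Q) b) (Equiv.sumCongr θ (Equiv.refl Prop))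

section

variable {T' : Set X} {b : U → X} {θ : Perm U}

theorem valExt_isRecolor [Finite X] (ha : Set.InjOn a Q)
    (haT : Set.MapsTo a Q T) (hb : Set.InjOn b (θ '' Q)) (hbT : Set.MapsTo b (θ '' Q) T')
    (hT : T.ncard = T'.ncard) : IsRecolor (valColor T Q a) (valColor T' (θ '' Q) b)
      (Equiv.sumCongr θ (Equiv.refl Prop)) (valExt T T' θ Q a b) :=
  recolor_spec (ncard_valColor_fiber θ ha haT hb hbT hT)

theorem valExt_apply [Finite X] (ha : Set.InjOn a Q)
    (haT : Set.MapsTo a Q T) (hb : Set.InjOn b (θ '' Q)) (hbT : Set.MapsTo b (θ '' Q) T')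
    (hT : T.ncard = T'.ncard) {y : U} (hy : y ∈ Q) :
    valExt T T' θ Q a b (a y) = b (θ y) := by
  have := (valExt_isRecolor ha haT hb hbT hT (a y)).1
  rw [valColor_apply ha hy] at this
  exact ((valColor_eq_inl hb).1 this).2.symm

theorem valExt_mem_iff [Finite X] (ha : Set.InjOn a Q)
    (haT : Set.MapsTo a Q T) (hb : Set.InjOn b (θ '' Q)) (hbT : Set.MapsTo b (θ '' Q) T')
    (hT : T.ncard = T'.ncard) (u : X) : valExt T T' θ Q a b u ∈ T' ↔ u ∈ T := by
  by_cases h : u ∈ a '' Q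
  · obtain ⟨y, hy, rfl⟩ := h
    rw [valExt_apply ha haT hb hbT hT hy]
    exact iff_of_true (hbT ⟨y, hy, rfl⟩) (haT hy)
  · have := (valExt_isRecolor ha haT hb hbT hT u).1
    rw [(valColor_eq_inr (T := T) (a := a) (Q := Q)).2 ⟨h, rfl⟩] at this
    exact (valColor_eq_inr.1 this).2.to_iff

theorem valExt_comp [Finite X] {T'' : Set X} {d : U → X} {θ' : Perm U} (ha : Set.InjOn a Q)
    (haT : Set.MapsTo a Q T) (hb : Set.InjOn b (θ '' Q)) (hbT : Set.MapsTo b (θ '' Q) T')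
    (hd : Set.InjOn d (θ' '' (θ '' Q))) (hdT : Set.MapsTo d (θ' '' (θ '' Q)) T'')
    (hT : T.ncard = T'.ncard) (hT' : T'.ncard = T''.ncard) :
    valExt T T'' (θ' * θ) Q a d = valExt T' T'' θ' (θ '' Q) b d * valExt T T' θ Q a b := by
  have e : (θ' * θ) '' Q = θ' '' (θ '' Q) := by
    rw [Set.image_image]
    rfl
  have h₁ := (valExt_isRecolor ha haT hb hbT hT).comp (valExt_isRecolor hb hbT hd hdT hT')
  have h₂ := valExt_isRecolor (T := T) (T' := T'') (θ := θ' * θ) (b := d) ha haT (e ▸ hd) (e ▸ hdT)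
    (hT.trans hT')
  rw [e] at h₂
  refine h₂.unique ?_
  convert h₁ using 1
  ext i : 1
  rcases i with i | i <;> rfl

end

end Recolor

/-! ### Destroying cliques that lie in no block. -/

variable {L : PermLang.{u, v}} {V : Type w}

namespace Stage

variable {A : GStr L V} {c : Prop} (S : Stage A c)

open Classical in
/-- A subset of `M` with one vertex less. -/
noncomputable def shrink {U : Type*} (M : Set U) : Set U :=
  if h : M.Nonempty then M \ {h.some} else ∅

theorem ncard_shrink {U : Type*} [Finite U] (M : Set U) :
    (shrink M).ncard = M.ncard - 1 := by
  by_cases h : M.Nonempty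
  · rw [shrink, dif_pos h, Set.ncard_sdiff_singleton_of_mem h.some_mem]
  · rw [shrink, dif_neg h, Set.not_nonempty_iff_eq_empty.1 h]
    simp

theorem ncard_shrink_image {U : Type*} [Finite U] (M : Set U) (θ : Perm U) :
    (shrink M).ncard = (shrink (θ '' M)).ncard := by
  rw [ncard_shrink, ncard_shrink, Set.ncard_image_of_injective _ θ.injective]

/-- The copy ψ(A) is itself a block, so it misses a vertex of `M` and meets `M` in at most |M| - 1
vertices, the number of available values. -/
theorem exists_injOn_shrink {M : Set S.U} (hM : ¬ ∃ g ∈ S.G, M ⊆ S.block g) :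
    ∃ s : S.U → S.U, Set.MapsTo s (M ∩ Set.range S.ψ.toFun) (shrink M) ∧
      Set.InjOn s (M ∩ Set.range S.ψ.toFun) := by
  classical
  have := S.fin
  have hlt : (M ∩ Set.range S.ψ.toFun).ncard < M.ncard := by
    refine Set.ncard_lt_ncard ⟨Set.inter_subset_left, fun h => hM ?_⟩ (Set.toFinite _)
    refine ⟨1, one_mem _, fun x hx => ?_⟩
    exact (h hx).2
  have hle : (M ∩ Set.range S.ψ.toFun).ncard ≤ (shrink M).ncard := by
    rw [ncard_shrink]
    omega
  by_cases hU : (M ∩ Set.range S.ψ.toFun).Nonempty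
  · have : Nonempty S.U := ⟨hU.some⟩
    obtain ⟨s, h₁, h₂⟩ := (Set.toFinite (M ∩ Set.range S.ψ.toFun)).exists_injOn_of_encard_le
      (t := shrink M) (by
        rw [← (Set.toFinite _).cast_ncard_eq, ← (Set.toFinite (shrink M)).cast_ncard_eq]
        exact_mod_cast hle)
    exact ⟨s, h₁, h₂⟩
  · rw [Set.not_nonempty_iff_eq_empty.1 hU]
    exact ⟨id, Set.mapsTo_empty _ _, Set.injOn_empty _⟩

open Classical in
/-- An injective valuation of the vertices of the copy of `A` in `M` with few values. -/
noncomputable def cliqueStd (M : Set S.U) : S.U → S.U :=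
  if h : ¬ ∃ g ∈ S.G, M ⊆ S.block g then (S.exists_injOn_shrink h).choose else id

/-- The valuation compatibility: distinct vertices have distinct values in `shrink M`. -/
def cliqueCompat (M : Set S.U) (y u y' u' : S.U) : Prop :=
  u ∈ shrink M ∧ u' ∈ shrink M ∧ (y ≠ y' → u ≠ u')

variable {S}

theorem cliqueCompat_injOn {M Q : Set S.U} {a : S.U → S.U}
    (h : ∀ y ∈ Q, ∀ y' ∈ Q, S.cliqueCompat M y (a y) y' (a y')) :
    Set.InjOn a Q ∧ Set.MapsTo a Q (shrink M) :=
  ⟨fun y hy y' hy' e => by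
    by_contra hne
    exact (h y hy y' hy').2.2 hne e, fun y hy => (h y hy y hy).1⟩

theorem cliqueCompat_injOn_image {M Q : Set S.U} {a : S.U → S.U} {θ : Perm S.U}
    (h : ∀ y ∈ Q, ∀ y' ∈ Q, S.cliqueCompat M (θ y) (a (θ y)) (θ y') (a (θ y'))) :
    Set.InjOn a (θ '' Q) ∧ Set.MapsTo a (θ '' Q) (shrink M) := by
  refine cliqueCompat_injOn ?_
  rintro _ ⟨y, hy, rfl⟩ _ ⟨y', hy', rfl⟩
  exact h y hy y' hy'

variable (S) in
/-- The valuations that destroy cliques outside of the copies of `A`. -/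
noncomputable def cliqueSystem : LocalSystem S :=
  haveI := S.fin
  -- Only the size of `shrink M` matters, so the vertices themselves can serve as values.
  { X := S.U
    finX := S.fin
    relevant := {M | ¬ ∃ g ∈ S.G, M ⊆ S.block g}
    map_relevant := by
      rintro g hg M hM ⟨h, hh, hMh⟩
      refine hM ⟨g⁻¹ * h, mul_mem (inv_mem hg) hh, fun x hx => ?_⟩
      have := map_mem_block (g := g⁻¹) (hMh ⟨x, hx, rfl⟩)
      simpa using this
    compat := S.cliqueCompat
    std := S.cliqueStd
    std_compat := by
      intro M hM y hy y' hy' h h'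
      replace hM : ¬ ∃ g ∈ S.G, M ⊆ S.block g := hM
      have hs := (S.exists_injOn_shrink hM).choose_spec
      rw [cliqueStd, dif_pos hM]
      exact ⟨hs.1 ⟨hy, h⟩, hs.1 ⟨hy', h'⟩, fun hne e => hne (hs.2 ⟨hy, h⟩ ⟨hy', h'⟩ e)⟩
    ext := fun θ M Q a b => valExt (shrink M) (shrink (θ '' M)) θ Q a b
    ext_apply := by
      intro g _ M _ Q _ _ a b ha hb y hy
      obtain ⟨ha₁, ha₂⟩ := cliqueCompat_injOn ha
      obtain ⟨hb₁, hb₂⟩ := cliqueCompat_injOn_image hb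
      exact valExt_apply ha₁ ha₂ hb₁ hb₂ (ncard_shrink_image M g.2) hy
    ext_compat := by
      intro g _ M _ Q _ _ a b ha hb y u y' u'
      obtain ⟨ha₁, ha₂⟩ := cliqueCompat_injOn ha
      obtain ⟨hb₁, hb₂⟩ := cliqueCompat_injOn_image hb
      have hm := valExt_mem_iff ha₁ ha₂ hb₁ hb₂ (ncard_shrink_image M g.2)
      simp only [cliqueCompat, hm, ne_eq, EmbeddingLike.apply_eq_iff_eq]
    ext_comp := by
      intro g _ h _ M _ Q _ _ a b d ha hb hd
      obtain ⟨ha₁, ha₂⟩ := cliqueCompat_injOn ha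
      obtain ⟨hb₁, hb₂⟩ := cliqueCompat_injOn_image hb
      have hd' : ∀ y ∈ g.2 '' Q, ∀ y' ∈ g.2 '' Q,
          S.cliqueCompat (h.2 '' (g.2 '' M)) (h.2 y) (d (h.2 y)) (h.2 y') (d (h.2 y')) := by
        rintro _ ⟨y, hy, rfl⟩ _ ⟨y', hy', rfl⟩
        exact hd y hy y' hy'
      obtain ⟨hd₁, hd₂⟩ := cliqueCompat_injOn_image hd'
      have e : (h.2 * g.2) '' M = h.2 '' (g.2 '' M) := by
        rw [Set.image_image]
        rfl
      have := valExt_comp ha₁ ha₂ hb₁ hb₂ hd₁ hd₂ (ncard_shrink_image M g.2)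
        (ncard_shrink_image _ h.2)
      rw [e]
      exact this }

/-- Let `M` be the union of the closures of the projected vertices of a clique. If no block
contained `M`, then `M` would be relevant and the decorations of the clique would inject `M` into
|M| - 1 values. -/
theorem cliqueSystem_conformal : S.cliqueSystem.cover.Conformal := by
  have := S.fin
  refine LocalSystem.cover_conformal fun C hC => ?_
  by_contra hcon
  let M : Set S.U := {y | ∃ v ∈ C, y ∈ S.B.cl v.1.1}
  have hM : M ∈ S.cliqueSystem.relevant := by
    rintro ⟨g, hg, h⟩
    exact hcon ⟨g, hg, fun v hv y hy => h ⟨v, hv, hy⟩⟩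
  have key : ∀ y ∈ M, ∃ u : S.U, ∃ v ∈ C, (y, M, u) ∈ v.1.2 := by
    rintro y ⟨v, hv, hy⟩
    obtain ⟨k, hk, a, ha⟩ := v.2
    have hy' := hy
    rw [ha] at hy'
    obtain ⟨u, hu⟩ := LocalSystem.exists_mem_vtx_snd hk hy' hM ⟨v, hv, hy⟩
    exact ⟨u, v, hv, by rw [ha]; exact hu⟩
  choose! s hs using key
  have hcompat : ∀ y ∈ M, ∀ y' ∈ M, S.cliqueCompat M y (s y) y' (s y') := by
    intro y hy y' hy'
    obtain ⟨v, hv, h⟩ := hs y hy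
    obtain ⟨v', hv', h'⟩ := hs y' hy'
    obtain ⟨k, hk, ⟨a, ha⟩, b, hb⟩ := LocalSystem.cover_adj_iff.1 (hC v hv v' hv')
    rw [ha] at h
    rw [hb] at h'
    exact (LocalSystem.decCompat_of_mem hk h h' rfl).2.2
  obtain ⟨h₁, h₂⟩ := cliqueCompat_injOn hcompat
  have hle := Set.ncard_le_ncard_of_injOn s h₂ h₁ (Set.toFinite _)
  rw [ncard_shrink] at hle
  -- The truncated |M| - 1 is smaller than |M| only for nonempty `M`; the empty set lies in a block
  -- and is not relevant.
  have hne : M.Nonempty := by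
    by_contra hne
    refine hM ⟨1, one_mem _, ?_⟩
    rw [Set.not_nonempty_iff_eq_empty.1 hne]
    exact Set.empty_subset _
  have := (Set.ncard_pos (Set.toFinite M)).2 hne
  omega

end Stage

end GStr

/-! ### Edge vectors over the field with two elements. -/

namespace GStr

open Equiv

section EdgeSpace

variable {U : Type*}

/-- The vector space of sets of edges. -/
abbrev EdgeSpace (U : Type*) : Type _ := Sym2 U → ZMod 2

theorem EdgeSpace.add_self (k : EdgeSpace U) : k + k = 0 :=
  funext fun z => CharTwo.add_self_eq_zero (k z)

open Classical in
/-- The vector of an edge. -/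
noncomputable def edgeVec (x y : U) : EdgeSpace U := Pi.single s(x, y) 1

theorem edgeVec_comm (x y : U) : edgeVec x y = edgeVec y x := by
  rw [edgeVec, edgeVec, Sym2.eq_swap]

/-- The action of a permutation of the vertices on sets of edges. -/
def mapEdge (θ : Perm U) : Perm (EdgeSpace U) where
  toFun k z := k (Sym2.map θ.symm z)
  invFun k z := k (Sym2.map θ z)
  left_inv k := by
    funext z
    simp [Sym2.map_map]
  right_inv k := by
    funext z
    simp [Sym2.map_map]

theorem mapEdge_add (θ : Perm U) (k l : EdgeSpace U) :
    mapEdge θ (k + l) = mapEdge θ k + mapEdge θ l := rfl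

theorem mapEdge_mul (θ θ' : Perm U) (k : EdgeSpace U) :
    mapEdge (θ' * θ) k = mapEdge θ' (mapEdge θ k) := by
  funext z
  simp only [mapEdge, Equiv.coe_fn_mk, Sym2.map_map]
  rfl

theorem mapEdge_edgeVec (θ : Perm U) (x y : U) :
    mapEdge θ (edgeVec x y) = edgeVec (θ x) (θ y) := by
  classical
  funext z
  simp only [mapEdge, edgeVec, Equiv.coe_fn_mk, Pi.single_apply]
  congr 1
  rw [eq_iff_iff]
  constructor
  · intro h
    have := congrArg (Sym2.map θ) h
    simpa [Sym2.map_map] using this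
  · rintro rfl
    simp

open Classical in
/-- The affine permutation of sets of edges that maps `a y` to `b (θ y)` for some `y` in `Q`. -/
noncomputable def edgeExt (θ : Perm U) (Q : Set U) (a b : U → EdgeSpace U) :
    Perm (EdgeSpace U) :=
  if h : Q.Nonempty then
    (mapEdge θ).trans (Equiv.addRight (mapEdge θ (a h.some) + b (θ h.some))) else mapEdge θ

/-- The map does not depend on the base point chosen in `Q`: by the hypotheses, `mapEdge θ` takes
differences of `a` to the corresponding differences of `b`. -/
theorem edgeExt_apply {θ : Perm U} {Q : Set U} {a b : U → EdgeSpace U}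
    (ha : ∀ y ∈ Q, ∀ y' ∈ Q, y ≠ y' → a y + a y' = edgeVec y y')
    (hb : ∀ y ∈ Q, ∀ y' ∈ Q, y ≠ y' → b (θ y) + b (θ y') = edgeVec (θ y) (θ y'))
    {y : U} (hy : y ∈ Q) (k : EdgeSpace U) :
    edgeExt θ Q a b k = mapEdge θ (k + a y) + b (θ y) := by
  have h : Q.Nonempty := ⟨y, hy⟩
  have key : mapEdge θ (a h.some) + b (θ h.some) = mapEdge θ (a y) + b (θ y) := by
    by_cases hne : h.some = y
    · rw [hne]
    · have h₁ := congrArg (mapEdge θ) (ha _ h.some_mem _ hy hne)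
      have h₂ := hb _ h.some_mem _ hy hne
      rw [mapEdge_edgeVec, ← h₂, mapEdge_add] at h₁
      have e₁ := EdgeSpace.add_self (mapEdge θ (a y))
      have e₂ := EdgeSpace.add_self (b (θ h.some))
      linear_combination h₁ - e₁ + e₂
  rw [edgeExt, dif_pos h, Equiv.trans_apply, Equiv.coe_addRight, key, mapEdge_add, add_assoc]

/-- The translation cancels in characteristic two. The constraint depends only on sums, so it is
transported by the linear part. -/
theorem edgeExt_add (θ : Perm U) (Q : Set U) (a b : U → EdgeSpace U) (k l : EdgeSpace U) :
    edgeExt θ Q a b k + edgeExt θ Q a b l = mapEdge θ (k + l) := by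
  by_cases h : Q.Nonempty
  · simp only [edgeExt, dif_pos h, Equiv.trans_apply, Equiv.coe_addRight, mapEdge_add]
    have e := EdgeSpace.add_self (mapEdge θ (a h.some) + b (θ h.some))
    linear_combination e
  · rw [edgeExt, dif_neg h, mapEdge_add]

end EdgeSpace

/-! ### Unwinding twisted sets. -/

variable {L : PermLang.{u, v}} {V : Type w}

namespace Stage

variable {A : GStr L V} {c : Prop} (S : Stage A c)

/-- `M` contains no triangles, and its edges are not the coboundary of a valuation in the space of
sets of edges. -/
structure Twisted (M : Set S.U) : Prop where
  triangle : ∀ x ∈ M, ∀ y ∈ M, ∀ z ∈ M, S.Adj x y → S.Adj y z → S.Adj x z →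
    x = y ∨ y = z ∨ x = z
  potential : ¬ ∃ k : S.U → EdgeSpace S.U, ∀ x ∈ M, ∀ y ∈ M, x ≠ y → S.Adj x y →
    k x + k y = edgeVec x y

variable {S}

theorem adj_of_mem_range {x y : S.U} (hx : x ∈ Set.range S.ψ.toFun)
    (hy : y ∈ Set.range S.ψ.toFun) : S.Adj x y := ⟨1, one_mem _, hx, hy⟩

theorem Twisted.map {g : L.Γ × Perm S.U} (hg : g ∈ S.G) {M : Set S.U} (hM : S.Twisted M) :
    S.Twisted (g.2 '' M) where
  triangle := by
    rintro _ ⟨x, hx, rfl⟩ _ ⟨y, hy, rfl⟩ _ ⟨z, hz, rfl⟩ h₁ h₂ h₃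
    simp only [adj_map_iff hg, EmbeddingLike.apply_eq_iff_eq] at *
    exact hM.triangle x hx y hy z hz h₁ h₂ h₃
  potential := by
    rintro ⟨k, hk⟩
    refine hM.potential ⟨fun x => (mapEdge g.2).symm (k (g.2 x)), fun x hx y hy hne h => ?_⟩
    apply (mapEdge g.2).injective
    rw [mapEdge_add, Equiv.apply_symm_apply, Equiv.apply_symm_apply, mapEdge_edgeVec]
    exact hk _ ⟨x, hx, rfl⟩ _ ⟨y, hy, rfl⟩ (fun e => hne (g.2.injective e)) (h.map hg)

variable (S) in
open Classical in
/-- A valuation of the vertices of the copy of `A` in `M`. -/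
noncomputable def twistStd (M : Set S.U) (y : S.U) : EdgeSpace S.U :=
  if h : (M ∩ Set.range S.ψ.toFun).Nonempty then
    if y = h.some then 0 else edgeVec h.some y else 0

/-- The part of `M` in ψ(A) is a clique in a triangle-free set, so it has at most two vertices, one
of them the base point with value 0. -/
theorem twistStd_add {M : Set S.U} (hM : S.Twisted M) {y y' : S.U} (hy : y ∈ M) (hy' : y' ∈ M)
    (h : y ∈ Set.range S.ψ.toFun) (h' : y' ∈ Set.range S.ψ.toFun) (hne : y ≠ y') :
    S.twistStd M y + S.twistStd M y' = edgeVec y y' := by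
  have hn : (M ∩ Set.range S.ψ.toFun).Nonempty := ⟨y, hy, h⟩
  rw [twistStd, twistStd, dif_pos hn, dif_pos hn]
  have hs := hn.some_mem
  rcases hM.triangle _ hs.1 y hy y' hy' (adj_of_mem_range hs.2 h) (adj_of_mem_range h h')
    (adj_of_mem_range hs.2 h') with e | e | e
  · rw [if_pos e.symm, if_neg (by rw [e]; exact hne.symm), e, zero_add]
  · exact (hne e).elim
  · rw [if_pos e.symm, if_neg (by rw [e]; exact hne), e, add_zero, edgeVec_comm]

variable (S) in
/-- The valuations that unwind twisted sets. -/
noncomputable def twistSystem : LocalSystem S :=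
  haveI := S.fin
  { X := EdgeSpace S.U
    finX := by
      have : Finite (Sym2 S.U) := Quot.finite _
      infer_instance
    relevant := {M | S.Twisted M}
    map_relevant := fun g hg M hM => Twisted.map hg hM
    compat := fun _ y k y' k' => y ≠ y' → S.Adj y y' → k + k' = edgeVec y y'
    std := S.twistStd
    std_compat := fun M hM y hy y' hy' h h' hne _ => twistStd_add hM hy hy' h h' hne
    ext := fun θ _ Q a b => edgeExt θ Q a b
    ext_apply := by
      intro g hg M hM Q _ hQ a b ha hb y hy
      have hadj : ∀ y ∈ Q, ∀ y' ∈ Q, S.Adj y y' := fun y hy y' hy' =>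
        adj_of_mem_range (hQ hy) (hQ hy')
      rw [edgeExt_apply (fun y hy y' hy' hne => ha y hy y' hy' hne (hadj y hy y' hy'))
        (fun y hy y' hy' hne => hb y hy y' hy' (fun e => hne (g.2.injective e))
          ((hadj y hy y' hy').map hg)) hy, EdgeSpace.add_self]
      exact zero_add _
    ext_compat := by
      intro g hg M hM Q _ hQ a b ha hb y k y' k'
      rw [edgeExt_add, adj_map_iff hg, ← mapEdge_edgeVec, EmbeddingLike.apply_eq_iff_eq, ne_eq,
        ne_eq, EmbeddingLike.apply_eq_iff_eq]
    ext_comp := by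
      intro g hg h hh M hM Q _ hQ a b d ha hb hd
      have hadj : ∀ y ∈ Q, ∀ y' ∈ Q, S.Adj y y' := fun y hy y' hy' =>
        adj_of_mem_range (hQ hy) (hQ hy')
      have ha' : ∀ y ∈ Q, ∀ y' ∈ Q, y ≠ y' → a y + a y' = edgeVec y y' :=
        fun y hy y' hy' hne => ha y hy y' hy' hne (hadj y hy y' hy')
      have hb' : ∀ y ∈ Q, ∀ y' ∈ Q, y ≠ y' → b (g.2 y) + b (g.2 y') = edgeVec (g.2 y) (g.2 y') :=
        fun y hy y' hy' hne => hb y hy y' hy' (fun e => hne (g.2.injective e))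
          ((hadj y hy y' hy').map hg)
      have hd' : ∀ y ∈ Q, ∀ y' ∈ Q, y ≠ y' → d (h.2 (g.2 y)) + d (h.2 (g.2 y')) =
          edgeVec (h.2 (g.2 y)) (h.2 (g.2 y')) :=
        fun y hy y' hy' hne => hd y hy y' hy'
          (fun e => hne (g.2.injective (h.2.injective e)))
          (((hadj y hy y' hy').map hg).map hh)
      refine Equiv.ext fun k => ?_
      rw [Perm.mul_apply]
      -- Without a base point all maps are linear; with base points `y` and `g.2 y`, the two middle
      -- terms `b (g.2 y)` cancel.
      rcases Q.eq_empty_or_nonempty with rfl | ⟨y, hy⟩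
      · have e₀ : ∀ (θ : Perm S.U) (a b : S.U → EdgeSpace S.U),
            edgeExt θ ∅ a b = mapEdge θ := fun θ a b => by
          rw [edgeExt, dif_neg Set.not_nonempty_empty]
        rw [Set.image_empty, e₀, e₀, e₀, mapEdge_mul]
      · rw [edgeExt_apply ha' hd' hy, edgeExt_apply ha' hb' hy,
          edgeExt_apply (Q := g.2 '' Q) (y := g.2 y) (a := b) ?_ ?_ ⟨y, hy, rfl⟩, add_assoc,
          EdgeSpace.add_self, add_zero, mapEdge_mul]
        · rfl
        · rintro _ ⟨y, hy, rfl⟩ _ ⟨y', hy', rfl⟩ hne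
          exact hb' y hy y' hy' (fun e => hne (congrArg _ e))
        · rintro _ ⟨y, hy, rfl⟩ _ ⟨y', hy', rfl⟩ hne
          exact hd' y hy y' hy' (fun e => hne (congrArg _ e)) }

theorem IsProj.adj {T S : Stage A c} {p : T.U → S.U} (hp : T.IsProj S p) {x y : T.U}
    (h : T.Adj x y) : S.Adj (p x) (p y) := by
  obtain ⟨g, hg, ⟨a, rfl⟩, ⟨b, rfl⟩⟩ := h
  obtain ⟨k, hk, -, h⟩ := hp.block g hg
  exact ⟨k, hk, ⟨a, (h a).symm⟩, ⟨b, (h b).symm⟩⟩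

/-- A clique projects to a clique, hence into a block, and blocks contain the closures of their
vertices. -/
theorem twistSystem_conformal (hS : S.Conformal) : S.twistSystem.cover.Conformal := by
  refine LocalSystem.cover_conformal fun C hC => ?_
  obtain ⟨g, hg, h⟩ := hS ((fun v => v.1.1) '' C) (by
    rintro _ ⟨v, hv, rfl⟩ _ ⟨w, hw, rfl⟩
    exact LocalSystem.cover_isProj.adj (hC v hv w hw))
  exact ⟨g, hg, fun v hv y hy => cl_subset_block hg (h ⟨v, hv, rfl⟩) hy⟩

/-- No set of vertices of the cover projects isomorphically to a twisted set. -/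
theorem not_twisted_of_lift {M : Set S.U} (s : S.U → S.twistSystem.cover.U)
    (hs : ∀ x ∈ M, (s x).1.1 = x)
    (hadj : ∀ x ∈ M, ∀ y ∈ M, S.Adj x y → S.twistSystem.cover.Adj (s x) (s y)) :
    ¬ S.Twisted M := by
  intro hM
  have hM' : M ∈ S.twistSystem.relevant := hM
  have key : ∀ y ∈ M, ∃ k : EdgeSpace S.U, (y, M, k) ∈ (s y).1.2 := by
    intro y hy
    obtain ⟨g, hg, a, ha⟩ := (s y).2
    rw [ha]
    refine LocalSystem.exists_mem_vtx_snd hg ?_ hM' hy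
    rw [← ha, hs y hy]
    exact mem_cl_self _ _
  choose! k hk using key
  refine hM.potential ⟨k, fun x hx y hy hne hxy => ?_⟩
  obtain ⟨g, hg, ⟨a, ha⟩, b, hb⟩ := LocalSystem.cover_adj_iff.1 (hadj x hx y hy hxy)
  have h₁ := hk x hx
  have h₂ := hk y hy
  rw [ha] at h₁
  rw [hb] at h₂
  exact (LocalSystem.decCompat_of_mem hg h₁ h₂ rfl).2.2 hne hxy

end Stage

end GStr

/-! ### Free amalgamations and restrictions of embeddings. -/

namespace GStr

open Equiv

variable {L : PermLang.{u, v}}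

section Amalgam

variable {X W₁ W₂ Y : Type w} {D : GStr L X} {B₁ : GStr L W₁} {B₂ : GStr L W₂}

/-- The structure on `Y` generated by the images of two structures. -/
def glue (B₁ : GStr L W₁) (B₂ : GStr L W₂) (b₁ : W₁ → Y) (b₂ : W₂ → Y) : GStr L Y where
  rel R := {z | (∃ x ∈ B₁.rel R, (fun i => b₁ (x i)) = z) ∨ ∃ x ∈ B₂.rel R, (fun i => b₂ (x i)) = z}
  fn F z := {y | (∃ x, b₁ x = z ∧ y ∈ b₁ '' B₁.fn F x) ∨ ∃ x, b₂ x = z ∧ y ∈ b₂ '' B₂.fn F x}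

/-- On the overlap both structures restrict to `D` with the same symbols, so `glue` adds no relation
or function value within either side. -/
theorem exists_isFreeAmalgam_of_maps (e₁ : Emb D B₁) (e₂ : Emb D B₂) (h₁ : e₁.lang = 1)
    (h₂ : e₂.lang = 1) (b₁ : W₁ → Y) (b₂ : W₂ → Y) (hb₁ : Function.Injective b₁)
    (hb₂ : Function.Injective b₂) (hcomm : ∀ d, b₁ (e₁.toFun d) = b₂ (e₂.toFun d))
    (hmeet : ∀ x y, b₁ x = b₂ y → ∃ d, e₁.toFun d = x ∧ e₂.toFun d = y)
    (hcover : ∀ z, z ∈ Set.range b₁ ∪ Set.range b₂) :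
    ∃ (C : GStr L Y) (β₁ : Emb B₁ C) (β₂ : Emb B₂ C), β₁.lang = 1 ∧ β₂.lang = 1 ∧
      IsFreeAmalgam e₁ e₂ β₁ β₂ := by
  have er₁ : ∀ {k : ℕ} (R : L.Rel k) x, x ∈ D.rel R ↔ (fun i => e₁.toFun (x i)) ∈ B₁.rel R := by
    intro k R x
    have := e₁.isEmbedding.rel_iff R x
    rwa [h₁] at this
  have er₂ : ∀ {k : ℕ} (R : L.Rel k) x, x ∈ D.rel R ↔ (fun i => e₂.toFun (x i)) ∈ B₂.rel R := by
    intro k R x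
    have := e₂.isEmbedding.rel_iff R x
    rwa [h₂] at this
  have ef₁ : ∀ F x, e₁.toFun '' D.fn F x = B₁.fn F (e₁.toFun x) := by
    intro F x
    have := e₁.isEmbedding.fn_eq F x
    rwa [h₁] at this
  have ef₂ : ∀ F x, e₂.toFun '' D.fn F x = B₂.fn F (e₂.toFun x) := by
    intro F x
    have := e₂.isEmbedding.fn_eq F x
    rwa [h₂] at this
  have hrel : ∀ {k : ℕ} (R : L.Rel k) (x : Fin (k + 1) → W₁) (y : Fin (k + 1) → W₂),
      (fun i => b₁ (x i)) = (fun i => b₂ (y i)) → (x ∈ B₁.rel R ↔ y ∈ B₂.rel R) := by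
    intro k R x y h
    choose d hd₁ hd₂ using fun i => hmeet (x i) (y i) (congrFun h i)
    obtain rfl : (fun i => e₁.toFun (d i)) = x := funext hd₁
    obtain rfl : (fun i => e₂.toFun (d i)) = y := funext hd₂
    rw [← er₁, ← er₂]
  have hfn : ∀ F x y, b₁ x = b₂ y → b₁ '' B₁.fn F x = b₂ '' B₂.fn F y := by
    intro F x y h
    obtain ⟨d, rfl, rfl⟩ := hmeet x y h
    rw [← ef₁, ← ef₂, Set.image_image, Set.image_image]
    exact Set.image_congr fun d _ => hcomm d
  have r₁ : ∀ {k : ℕ} (R : L.Rel k) x, x ∈ B₁.rel R ↔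
      (fun i => b₁ (x i)) ∈ (glue B₁ B₂ b₁ b₂).rel R := by
    intro k R x
    refine ⟨fun h => Or.inl ⟨x, h, rfl⟩, ?_⟩
    rintro (⟨y, hy, h⟩ | ⟨y, hy, h⟩)
    · obtain rfl : y = x := funext fun i => hb₁ (congrFun h i)
      exact hy
    · exact (hrel R x y h.symm).2 hy
  have r₂ : ∀ {k : ℕ} (R : L.Rel k) x, x ∈ B₂.rel R ↔
      (fun i => b₂ (x i)) ∈ (glue B₁ B₂ b₁ b₂).rel R := by
    intro k R x
    refine ⟨fun h => Or.inr ⟨x, h, rfl⟩, ?_⟩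
    rintro (⟨y, hy, h⟩ | ⟨y, hy, h⟩)
    · exact (hrel R y x h).1 hy
    · obtain rfl : y = x := funext fun i => hb₂ (congrFun h i)
      exact hy
  have f₁ : ∀ F x, b₁ '' B₁.fn F x = (glue B₁ B₂ b₁ b₂).fn F (b₁ x) := by
    intro F x
    refine Set.Subset.antisymm (fun y hy => Or.inl ⟨x, rfl, hy⟩) ?_
    rintro y (⟨z, hz, h⟩ | ⟨z, hz, h⟩)
    · rwa [hb₁ hz] at h
    · rwa [hfn F x z hz.symm]
  have f₂ : ∀ F x, b₂ '' B₂.fn F x = (glue B₁ B₂ b₁ b₂).fn F (b₂ x) := by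
    intro F x
    refine Set.Subset.antisymm (fun y hy => Or.inr ⟨x, rfl, hy⟩) ?_
    rintro y (⟨z, hz, h⟩ | ⟨z, hz, h⟩)
    · rwa [← hfn F z x hz]
    · rwa [hb₂ hz] at h
  refine ⟨glue B₁ B₂ b₁ b₂,
    ⟨⟨1, b₁, fun R x hx => (r₁ R x).1 hx, fun F x => (f₁ F x).subset⟩, ⟨hb₁, r₁, f₁⟩⟩,
    ⟨⟨1, b₂, fun R x hx => (r₂ R x).1 hx, fun F x => (f₂ F x).subset⟩, ⟨hb₂, r₂, f₂⟩⟩,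
    rfl, rfl, ?_, ?_, ?_, ?_⟩
  · refine Emb.ext' ?_ hcomm
    change 1 * e₁.lang = 1 * e₂.lang
    rw [h₁, h₂]
  · intro x y h
    obtain ⟨d, rfl, rfl⟩ := hmeet x y h
    exact ⟨⟨d, rfl⟩, ⟨d, rfl⟩⟩
  · exact Set.eq_univ_of_forall hcover
  · rintro k R x ⟨i, y, hy, hi⟩ ⟨j, z, hz, hj⟩ (⟨t, _, rfl⟩ | ⟨t, _, rfl⟩)
    · obtain ⟨d, -, rfl⟩ := hmeet (t j) z hj.symm
      exact hz ⟨d, rfl⟩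
    · obtain ⟨d, rfl, -⟩ := hmeet y (t i) hi
      exact hy ⟨d, rfl⟩

/-- Free amalgamations exist. -/
theorem exists_isFreeAmalgam (e₁ : Emb D B₁) (e₂ : Emb D B₂) (h₁ : e₁.lang = 1)
    (h₂ : e₂.lang = 1) :
    ∃ (Y : Type w) (C : GStr L Y) (β₁ : Emb B₁ C) (β₂ : Emb B₂ C), β₁.lang = 1 ∧ β₂.lang = 1 ∧
      IsFreeAmalgam e₁ e₂ β₁ β₂ := by
  classical
  let b₂ : W₂ → W₁ ⊕ {y : W₂ // ¬ ∃ d, e₂.toFun d = y} := fun y =>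
    if h : ∃ d, e₂.toFun d = y then Sum.inl (e₁.toFun h.choose) else Sum.inr ⟨y, h⟩
  have hb : ∀ d, b₂ (e₂.toFun d) = Sum.inl (e₁.toFun d) := by
    intro d
    have h : ∃ d', e₂.toFun d' = e₂.toFun d := ⟨d, rfl⟩
    simp only [b₂, dif_pos h]
    rw [e₂.isEmbedding.injective h.choose_spec]
  have hb' : ∀ y (h : ¬ ∃ d, e₂.toFun d = y), b₂ y = Sum.inr ⟨y, h⟩ := fun y h => dif_neg h
  refine ⟨_, exists_isFreeAmalgam_of_maps e₁ e₂ h₁ h₂ Sum.inl b₂ Sum.inl_injective ?_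
    (fun d => (hb d).symm) ?_ ?_⟩
  · intro y z h
    by_cases hy : ∃ d, e₂.toFun d = y <;> by_cases hz : ∃ d, e₂.toFun d = z
    · obtain ⟨d, rfl⟩ := hy
      obtain ⟨d', rfl⟩ := hz
      rw [hb, hb] at h
      rw [e₁.isEmbedding.injective (Sum.inl_injective h)]
    · obtain ⟨d, rfl⟩ := hy
      rw [hb, hb' z hz] at h
      cases h
    · obtain ⟨d, rfl⟩ := hz
      rw [hb, hb' y hy] at h
      cases h
    · rw [hb' y hy, hb' z hz] at h
      exact congrArg Subtype.val (Sum.inr_injective h)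
  · intro x y h
    by_cases hy : ∃ d, e₂.toFun d = y
    · obtain ⟨d, rfl⟩ := hy
      rw [hb] at h
      exact ⟨d, (Sum.inl_injective h).symm, rfl⟩
    · rw [hb' y hy] at h
      cases h
  · rintro (x | y)
    · exact Or.inl ⟨x, rfl⟩
    · exact Or.inr ⟨y.1, hb' y.1 y.2⟩

end Amalgam

section Restrict

variable {V W : Type*} {A : GStr L V} {B : GStr L W}

/-- An embedding as an embedding to its image. -/
def Emb.toRange (e : Emb A B) : Emb A e.range.str where
  lang := e.lang
  toFun a := ⟨e.toFun a, a, rfl⟩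
  map_rel R x hx := e.map_rel R x hx
  map_fn F x := by
    rintro _ ⟨y, hy, rfl⟩
    exact e.map_fn F x ⟨y, hy, rfl⟩
  isEmbedding :=
    { injective := fun a b h => e.isEmbedding.injective (congrArg Subtype.val h)
      rel_iff := fun R x => e.isEmbedding.rel_iff R x
      fn_eq := fun F x => by
        ext ⟨z, hz⟩
        have := Set.ext_iff.1 (e.isEmbedding.fn_eq F x) z
        refine Iff.trans ?_ this
        constructor
        · rintro ⟨y, hy, h⟩
          exact ⟨y, hy, congrArg Subtype.val h⟩
        · rintro ⟨y, hy, h⟩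
          exact ⟨y, hy, Subtype.ext h⟩ }

theorem Emb.toRange_isIso (e : Emb A B) : e.toRange.toHom.IsIso where
  toIsEmbedding := e.toRange.isEmbedding
  surjective := by
    rintro ⟨_, a, rfl⟩
    exact ⟨a, rfl⟩

/-- A substructure of the image of an embedding, embedded into the domain. -/
noncomputable def Emb.pullback (e : Emb A B) (K : Substr B) (hK : K.carrier ⊆ Set.range e.toFun) :
    Emb K.str A :=
  have hs : ∀ x : K.carrier, e.toFun (hK x.2).choose = x.1 := fun x => (hK x.2).choose_spec
  have hrel : ∀ {k : ℕ} (R : L.Rel k) (x : Fin (k + 1) → K.carrier), x ∈ K.str.rel R ↔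
      (fun i => (hK (x i).2).choose) ∈ A.rel (PermLang.onRel e.lang⁻¹ R) := fun R x => by
    rw [e.isEmbedding.rel_iff, onRel_onRel_inv]
    simp only [hs]
    rfl
  have hfn : ∀ (F : L.Fn) (x : K.carrier), (fun y : K.carrier => (hK y.2).choose) '' K.str.fn F x =
      A.fn (PermLang.onFn e.lang⁻¹ F) (hK x.2).choose := fun F x => by
    have h := e.isEmbedding.fn_eq (PermLang.onFn e.lang⁻¹ F) (hK x.2).choose
    rw [onFn_onFn_inv, hs] at h
    ext a
    constructor
    · rintro ⟨y, hy, rfl⟩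
      have hy' : y.1 ∈ B.fn F x.1 := hy
      rw [← h] at hy'
      obtain ⟨b, hb, hby⟩ := hy'
      dsimp only
      rwa [e.isEmbedding.injective ((hs y).trans hby.symm)]
    · intro ha
      have h' : e.toFun a ∈ B.fn F x.1 := h ▸ ⟨a, ha, rfl⟩
      exact ⟨⟨e.toFun a, K.closed F x.1 x.2 h'⟩, h', e.isEmbedding.injective (hs _)⟩
  { lang := e.lang⁻¹
    toFun := fun x => (hK x.2).choose
    map_rel := fun R x hx => (hrel R x).1 hx
    map_fn := fun F x => (hfn F x).subset
    isEmbedding :=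
      { injective := fun x y h => by
          have h' : (hK x.2).choose = (hK y.2).choose := h
          exact Subtype.ext ((hs x).symm.trans ((congrArg e.toFun h').trans (hs y)))
        rel_iff := hrel
        fn_eq := hfn } }

theorem Emb.apply_pullback (e : Emb A B) (K : Substr B) (hK : K.carrier ⊆ Set.range e.toFun)
    (x : K.carrier) : e.toFun ((e.pullback K hK).toFun x) = x :=
  (hK x.2).choose_spec

end Restrict

/-! ### Chordality and maps to tree amalgamations. -/

namespace Stage

variable {V : Type w} {A : GStr L V} {c : Prop} {S : Stage A c}

/-- A walk from `s` to `t` of length `m` with inner vertices in `K`. -/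
structure IsWalk (S : Stage A c) (K : Set S.U) (s t : S.U) (m : ℕ) (f : ℕ → S.U) : Prop where
  zero : f 0 = s
  last : f m = t
  adj : ∀ i < m, S.Adj (f i) (f (i + 1))
  inner : ∀ i, 0 < i → i < m → f i ∈ K

/-- The `j - i - 1` vertices strictly between positions `i` and `j` are skipped. Consequently a
shortest walk has no chords. -/
theorem IsWalk.shortcut {K : Set S.U} {s t : S.U} {m : ℕ} {f : ℕ → S.U} (h : S.IsWalk K s t m f)
    {i j : ℕ} (hij : i < j) (hj : j ≤ m) (hadj : S.Adj (f i) (f j)) :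
    S.IsWalk K s t (m - (j - i - 1)) fun k => if k ≤ i then f k else f (k + (j - i - 1)) where
  zero := by simp [h.zero]
  last := by
    have h₁ : ¬ m - (j - i - 1) ≤ i := by omega
    have h₂ : m - (j - i - 1) + (j - i - 1) = m := by omega
    rw [if_neg h₁, h₂, h.last]
  adj k hk := by
    rcases lt_trichotomy k i with hki | rfl | hki
    · rw [if_pos hki.le, if_pos (by omega)]
      exact h.adj k (by omega)
    · rw [if_pos le_rfl, if_neg (by omega), show k + 1 + (j - k - 1) = j by omega]
      exact hadj
    · rw [if_neg (by omega), if_neg (by omega),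
        show k + 1 + (j - i - 1) = k + (j - i - 1) + 1 by omega]
      exact h.adj _ (by omega)
  inner k hk₀ hk := by
    by_cases hki : k ≤ i
    · rw [if_pos hki]
      exact h.inner k hk₀ (by omega)
    · rw [if_neg hki]
      exact h.inner _ (by omega) (by omega)

/-- A vertex outside of a walk, adjacent exactly to its nonadjacent ends, gives a twisted set. -/
theorem exists_twisted (hS : S.Covered) {K : Set S.U} {x s t : S.U} {m : ℕ} {f : ℕ → S.U}
    (hf : S.IsWalk K s t m f) (hK : ∀ k ∈ K, ¬ S.Adj x k) (hxs : S.Adj x s) (hxt : S.Adj x t)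
    (hst : ¬ S.Adj s t) (hs : x ≠ s) (ht : x ≠ t) :
    ∃ M : Set S.U, S.Twisted M ∧ M ⊆ insert x (insert s (insert t K)) := by
  classical
  -- A shortest walk is an induced path, and adding `x` closes it to an induced cycle of length at
  -- least four.
  have hex : ∃ m f, S.IsWalk K s t m f := ⟨m, f, hf⟩
  obtain ⟨f, hf⟩ := Nat.find_spec hex
  have hmin : ∀ l < Nat.find hex, ¬ ∃ f, S.IsWalk K s t l f := fun l hl => Nat.find_min hex hl
  generalize Nat.find hex = m at hf hmin
  have hnear : ∀ i j, i < j → j ≤ m → S.Adj (f i) (f j) → j = i + 1 := by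
    intro i j hij hj hadj
    by_contra hne
    exact hmin (m - (j - i - 1)) (by omega) ⟨_, hf.shortcut hij hj hadj⟩
  have hnear' : ∀ i j, i ≤ m → j ≤ m → S.Adj (f i) (f j) → j ≤ i + 1 ∧ i ≤ j + 1 := by
    intro i j hi hj hadj
    rcases lt_trichotomy i j with h | h | h
    · have := hnear i j h hj hadj
      omega
    · omega
    · have := hnear j i h hi hadj.symm
      omega
  have hends : ∀ i ≤ m, S.Adj x (f i) → i = 0 ∨ i = m := by
    intro i hi hadj
    by_contra hne
    exact hK _ (hf.inner i (by omega) (by omega)) hadj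
  have hxf : ∀ i ≤ m, x ≠ f i := by
    intro i hi e
    rcases hends i hi (e ▸ hS.adj_self x) with rfl | rfl
    · exact hs (e.trans hf.zero)
    · exact ht (e.trans hf.last)
  have hpair : ∀ i j, i ≤ m → j ≤ m → S.Adj x (f i) → S.Adj x (f j) → S.Adj (f i) (f j) →
      i = j := by
    intro i j hi hj hi' hj' hadj
    rcases hends i hi hi' with rfl | rfl <;> rcases hends j hj hj' with rfl | rfl
    · rfl
    · rw [hf.zero, hf.last] at hadj
      exact (hst hadj).elim
    · rw [hf.zero, hf.last] at hadj
      exact (hst hadj.symm).elim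
    · rfl
  refine ⟨insert x {z | ∃ i ≤ m, f i = z}, ⟨?_, ?_⟩, ?_⟩
  · rintro a (rfl | ⟨i, hi, rfl⟩) b (rfl | ⟨j, hj, rfl⟩) d (rfl | ⟨k, hk, rfl⟩) h₁ h₂ h₃
    · exact Or.inl rfl
    · exact Or.inl rfl
    · exact Or.inr (Or.inr rfl)
    · rw [hpair j k hj hk h₁ h₃ h₂]
      exact Or.inr (Or.inl rfl)
    · exact Or.inr (Or.inl rfl)
    · rw [hpair i k hi hk h₁.symm h₂ h₃]
      exact Or.inr (Or.inr rfl)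
    · rw [hpair i j hi hj h₃.symm h₂.symm h₁]
      exact Or.inl rfl
    · have e₁ := hnear' i j hi hj h₁
      have e₂ := hnear' j k hj hk h₂
      have e₃ := hnear' i k hi hk h₃
      have : i = j ∨ j = k ∨ i = k := by omega
      rcases this with e | e | e
      · exact Or.inl (by rw [e])
      · exact Or.inr (Or.inl (by rw [e]))
      · exact Or.inr (Or.inr (by rw [e]))
  · rintro ⟨q, hq⟩
    -- Follow the coordinate of the edge `xs` of a potential: it is constant along the path from `s`
    -- to `t` and unchanged from `t` to `x`, but the edge from `x` to `s` changes it by one.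
    have hconst : ∀ i ≤ m, q (f i) s(x, s) = q s s(x, s) := by
      intro i
      induction i with
      | zero => intro _; rw [hf.zero]
      | succ i ih =>
        intro hi
        by_cases hne : f i = f (i + 1)
        · rw [← hne]
          exact ih (by omega)
        · have h := congrFun (hq (f i) (Or.inr ⟨i, by omega, rfl⟩) (f (i + 1))
            (Or.inr ⟨i + 1, hi, rfl⟩) hne (hf.adj i (by omega))) s(x, s)
          have hz : edgeVec (f i) (f (i + 1)) s(x, s) = 0 := by
            rw [edgeVec, Pi.single_apply, if_neg]
            intro e
            rcases Sym2.eq_iff.1 e with ⟨e, _⟩ | ⟨e, _⟩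
            · exact hxf i (by omega) e
            · exact hxf (i + 1) hi e
          rw [hz, Pi.add_apply, CharTwo.add_eq_zero] at h
          rw [← h]
          exact ih (by omega)
    have hne : s ≠ t := by
      rintro rfl
      exact hst (hS.adj_self s)
    have h₁ := congrFun (hq x (Or.inl rfl) t (Or.inr ⟨m, le_rfl, hf.last⟩) ht hxt) s(x, s)
    have h₂ := congrFun (hq x (Or.inl rfl) s (Or.inr ⟨0, Nat.zero_le _, hf.zero⟩) hs hxs) s(x, s)
    have h₃ := hconst m le_rfl
    rw [hf.last] at h₃
    have hz : edgeVec x t s(x, s) = 0 := by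
      rw [edgeVec, Pi.single_apply, if_neg]
      intro e
      rcases Sym2.eq_iff.1 e with ⟨_, e⟩ | ⟨e, _⟩
      · exact hne e
      · exact ht e
    rw [hz, Pi.add_apply, CharTwo.add_eq_zero, h₃] at h₁
    rw [Pi.add_apply, h₁, CharTwo.add_self_eq_zero, edgeVec, Pi.single_eq_same] at h₂
    exact zero_ne_one h₂
  · rintro z (rfl | ⟨i, hi, rfl⟩)
    · exact Or.inl rfl
    · by_cases h₀ : i = 0
      · rw [h₀, hf.zero]
        exact Or.inr (Or.inl rfl)
      · by_cases hm : i = m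
        · rw [hm, hf.last]
          exact Or.inr (Or.inr (Or.inl rfl))
        · exact Or.inr (Or.inr (Or.inr (hf.inner i (by omega) (by omega))))

theorem IsWalk.snoc {K : Set S.U} {s l t : S.U} {m : ℕ} {f : ℕ → S.U} (hf : S.IsWalk K s l m f)
    (hl : l ∈ K) (h : S.Adj l t) : ∃ f, S.IsWalk K s t (m + 1) f := by
  classical
  refine ⟨fun i => if i ≤ m then f i else t, ⟨(if_pos (Nat.zero_le _)).trans hf.zero,
    if_neg (by omega), fun i hi => ?_, fun i hi₀ hi => ?_⟩⟩
  · by_cases him : i = m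
    · subst him
      rw [if_pos le_rfl, if_neg (by omega), hf.last]
      exact h
    · rw [if_pos (by omega), if_pos (by omega)]
      exact hf.adj i (by omega)
  · rw [if_pos (by omega)]
    by_cases him : i = m
    · rw [him, hf.last]
      exact hl
    · exact hf.inner i hi₀ (by omega)

theorem exists_isWalk_of_reflTransGen {K : Set S.U} {s k l : S.U} (hk : k ∈ K)
    (hsk : S.Adj s k) (h : Relation.ReflTransGen (fun a b => S.Adj a b ∧ b ∈ K) k l) :
    l ∈ K ∧ ∃ m f, S.IsWalk K s l m f := by
  classical
  induction h with
  | refl =>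
    refine ⟨hk, 1, fun i => if i = 0 then s else k, ⟨rfl, rfl, fun i hi => ?_, fun i _ _ => ?_⟩⟩
    · obtain rfl : i = 0 := by omega
      exact hsk
    · omega
  | tail _ h ih =>
    obtain ⟨hl, m, f, hf⟩ := ih
    exact ⟨h.2, m + 1, hf.snoc hl h.1⟩

/-- A substructure without twisted sets is a clique or has a separating clique. -/
theorem exists_separation (hS : S.Covered) (C : Substr S.B)
    (hC : ∀ M ⊆ C.carrier, ¬ S.Twisted M) {x y : S.U} (hx : x ∈ C.carrier) (hy : y ∈ C.carrier)
    (hxy : ¬ S.Adj x y) : ∃ C₁ C₂ : Substr S.B, C₁.carrier ∪ C₂.carrier = C.carrier ∧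
      x ∉ C₁.carrier ∧ y ∉ C₂.carrier ∧
      (∀ a ∈ C₁.carrier ∩ C₂.carrier, ∀ b ∈ C₁.carrier ∩ C₂.carrier, S.Adj a b) ∧
      ∀ a ∈ C₁.carrier, a ∉ C₂.carrier → ∀ b ∈ C₂.carrier, b ∉ C₁.carrier → ¬ S.Adj a b := by
  -- Dirac's argument: `K` is the component of `y` in `C` after removing `x` and its neighbours, and
  -- `N` consists of the neighbours of `x` that are adjacent to `K`.
  let r : S.U → S.U → Prop := fun a b => S.Adj a b ∧ b ∈ C.carrier ∧ ¬ S.Adj x b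
  let K : Set S.U := {z | Relation.ReflTransGen r y z}
  have hyK : y ∈ K := Relation.ReflTransGen.refl
  have hKC : ∀ k ∈ K, k ∈ C.carrier ∧ ¬ S.Adj x k := by
    intro k hk
    rcases Relation.ReflTransGen.cases_tail hk with rfl | ⟨_, _, h⟩
    · exact ⟨hy, hxy⟩
    · exact h.2
  have hKstep : ∀ k ∈ K, ∀ z ∈ C.carrier, S.Adj k z → ¬ S.Adj x z → z ∈ K :=
    fun k hk z hz h h' => Relation.ReflTransGen.tail hk ⟨h, hz, h'⟩
  let N : Set S.U := {z | z ∈ C.carrier ∧ S.Adj x z ∧ ∃ k ∈ K, S.Adj z k}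
  have hNK : ∀ z ∈ N, z ∉ K := fun z hz hz' => (hKC z hz').2 hz.2.1
  have hNcl : ∀ z ∈ N, ∀ z' ∈ S.B.cl z, z' ∈ N := by
    rintro z ⟨hzC, hxz, k, hk, hzk⟩ z' hz'
    exact ⟨cl_subset_of_closed C.closed hzC hz', hxz.cl_right hz', k, hk,
      (hzk.symm.cl_right hz').symm⟩
  have hKnbr : ∀ k ∈ K, ∀ z ∈ C.carrier, S.Adj k z → z ∈ K ∨ z ∈ N := by
    intro k hk z hz h
    by_cases h' : S.Adj x z
    · exact Or.inr ⟨hz, h', k, hk, h.symm⟩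
    · exact Or.inl (hKstep k hk z hz h h')
  have hKsymm : ∀ k ∈ K, ∀ l ∈ K, Relation.ReflTransGen (fun a b => S.Adj a b ∧ b ∈ K) k l := by
    have h₁ : ∀ k ∈ K, Relation.ReflTransGen (fun a b => S.Adj a b ∧ b ∈ K) y k ∧
        Relation.ReflTransGen (fun a b => S.Adj a b ∧ b ∈ K) k y := by
      intro k hk
      induction hk with
      | refl => exact ⟨Relation.ReflTransGen.refl, Relation.ReflTransGen.refl⟩
      | tail h h' ih =>
        exact ⟨ih.1.tail ⟨h'.1, Relation.ReflTransGen.tail h h'⟩,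
          Relation.ReflTransGen.head ⟨h'.1.symm, h⟩ ih.2⟩
    exact fun k hk l hl => (h₁ k hk).2.trans (h₁ l hl).1
  have hxN : x ∉ N := by
    rintro ⟨-, -, k, hk, h⟩
    exact (hKC k hk).2 h
  have hxK : x ∉ K := fun h => (hKC x h).2 (hS.adj_self x)
  have hinter : ∀ a, a ∈ K ∪ N → a ∈ C.carrier \ K → a ∈ N := fun a h₁ h₂ =>
    h₁.resolve_left h₂.2
  -- The two parts meet exactly in `N`. They are closed under functions because adjacency to a
  -- vertex extends to its closure.
  refine ⟨⟨K ∪ N, ?_⟩, ⟨C.carrier \ K, ?_⟩, ?_, ?_, ?_, ?_, ?_⟩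
  · rintro F z (hz | hz) z' hz'
    · exact hKnbr z hz z' (C.closed F z (hKC z hz).1 hz')
        ((hS.adj_self z).cl_right (fn_subset_cl hz'))
    · exact Or.inr (hNcl z hz z' (fn_subset_cl hz'))
  · rintro F z ⟨hz, hzK⟩ z' hz'
    refine ⟨C.closed F z hz hz', fun h => ?_⟩
    have hadj := ((hS.adj_self z).cl_right (fn_subset_cl hz')).symm
    rcases hKnbr z' h z hz hadj with h' | h'
    · exact hzK h'
    · exact hNK z' (hNcl z h' z' (fn_subset_cl hz')) h
  · ext z
    constructor
    · rintro ((h | h) | h)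
      · exact (hKC z h).1
      · exact h.1
      · exact h.1
    · intro h
      by_cases h' : z ∈ K
      · exact Or.inl (Or.inl h')
      · exact Or.inr ⟨h, h'⟩
  · rintro (h | h)
    · exact hxK h
    · exact hxN h
  · exact fun h => h.2 hyK
  · rintro s ⟨hs₁, hs₂⟩ t ⟨ht₁, ht₂⟩
    by_contra hst
    have hs := hinter s hs₁ hs₂
    have ht := hinter t ht₁ ht₂
    obtain ⟨hsC, hxs, k, hk, hsk⟩ := hs
    obtain ⟨htC, hxt, l, hl, htl⟩ := ht
    -- Nonadjacent `s` and `t` in `N` are joined by a walk through `K`, none of whose inner vertices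
    -- is adjacent to `x`; this produces a twisted set in `C`.
    obtain ⟨hlK, m, f, hf⟩ := exists_isWalk_of_reflTransGen hk hsk (hKsymm k hk l hl)
    obtain ⟨f', hf'⟩ := hf.snoc hlK htl.symm
    obtain ⟨M, hM, hMsub⟩ := exists_twisted hS hf' (fun k hk => (hKC k hk).2) hxs hxt hst
      (by rintro rfl; exact (hKC k hk).2 hsk) (by rintro rfl; exact (hKC l hl).2 htl)
    refine hC M (hMsub.trans ?_) hM
    rintro z (rfl | rfl | rfl | hz)
    · exact hx
    · exact hsC
    · exact htC
    · exact (hKC z hz).1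
  · rintro a ha ha' b hb hb' hadj
    have haK : a ∈ K := by
      by_contra h
      rcases ha with h' | h'
      · exact h h'
      · exact ha' ⟨h'.1, h⟩
    exact hb' (hKnbr a haK b hb.1 hadj)

/-- A map from `C` to a tree amalgamation that agrees with an embedding of `A` on every clique. -/
def HasTreeMap (S : Stage A c) (C : Substr S.B) : Prop :=
  ∃ (Z : Type w) (D : GStr L Z), IsTreeAmalgam A D ∧ ∃ f : S.U → Z, ∀ K : Substr S.B,
    K.carrier ⊆ C.carrier → (∀ x ∈ K.carrier, ∀ y ∈ K.carrier, S.Adj x y) →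
    ∃ g ∈ S.G, K.carrier ⊆ S.block g ∧ ∃ α : Emb A D, α.lang = g.1 * S.ψ.lang ∧
      ∀ a, g.2 (S.ψ.toFun a) ∈ K.carrier → f (g.2 (S.ψ.toFun a)) = α.toFun a

theorem hasTreeMap_of_clique (hS : S.Covered) (hS' : S.Conformal) (C : Substr S.B)
    (hC : ∀ x ∈ C.carrier, ∀ y ∈ C.carrier, S.Adj x y) : S.HasTreeMap C := by
  classical
  obtain ⟨g, hg, h⟩ := hS' C.carrier hC
  have hD : IsTreeAmalgam A (chart hg).range.str := .copy _ (chart hg).toRange_isIso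
  have key : ∃ f : S.U → (chart hg).range.carrier, ∀ a,
      f (g.2 (S.ψ.toFun a)) = (chart hg).toRange.toFun a := by
    -- Vertices outside of the block get an arbitrary value; if `A` is empty, a covered stage has no
    -- vertices at all.
    by_cases hV : Nonempty V
    · refine ⟨fun x => if h : x ∈ (chart hg).range.carrier then ⟨x, h⟩ else
        (chart hg).toRange.toFun hV.some, fun a => ?_⟩
      exact dif_pos (c := g.2 (S.ψ.toFun a) ∈ (chart hg).range.carrier) ⟨a, rfl⟩
    · refine ⟨fun x => (hV ?_).elim, fun a => (hV ⟨a⟩).elim⟩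
      obtain ⟨_, _, a, _⟩ := hS.vertex x
      exact ⟨a⟩
  obtain ⟨f, hf⟩ := key
  exact ⟨_, _, hD, f, fun K hK _ => ⟨g, hg, hK.trans h, (chart hg).toRange, rfl, fun a _ => hf a⟩⟩

/-- The overlap is a clique, so on it each map agrees with an embedding of `A`; this is the data for
amalgamating the two tree amalgamations. Every clique of `C` lies on one side, so the glued map
inherits the property. -/
theorem hasTreeMap_of_separation {C C₁ C₂ : Substr S.B}
    (hU : C₁.carrier ∪ C₂.carrier = C.carrier)
    (hI : ∀ a ∈ C₁.carrier ∩ C₂.carrier, ∀ b ∈ C₁.carrier ∩ C₂.carrier, S.Adj a b)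
    (hsep : ∀ a ∈ C₁.carrier, a ∉ C₂.carrier → ∀ b ∈ C₂.carrier, b ∉ C₁.carrier → ¬ S.Adj a b)
    (h₁ : S.HasTreeMap C₁) (h₂ : S.HasTreeMap C₂) : S.HasTreeMap C := by
  classical
  obtain ⟨Z₁, D₁, hD₁, f₁, hf₁⟩ := h₁
  obtain ⟨Z₂, D₂, hD₂, f₂, hf₂⟩ := h₂
  obtain ⟨g₁, hg₁, hb₁, α₁, hl₁, hα₁⟩ := hf₁ (C₁.inter C₂) Set.inter_subset_left hI
  obtain ⟨g₂, hg₂, hb₂, α₂, hl₂, hα₂⟩ := hf₂ (C₁.inter C₂) Set.inter_subset_right hI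
  let δ₁ := (chart hg₁).pullback (C₁.inter C₂) hb₁
  let δ₂ := (chart hg₂).pullback (C₁.inter C₂) hb₂
  have hδ₁ : ∀ x, α₁.toFun (δ₁.toFun x) = f₁ x := fun x => by
    have h : g₁.2 (S.ψ.toFun (δ₁.toFun x)) = x := (chart hg₁).apply_pullback _ hb₁ x
    rw [← hα₁ _ (h ▸ x.2), h]
  have hδ₂ : ∀ x, α₂.toFun (δ₂.toFun x) = f₂ x := fun x => by
    have h : g₂.2 (S.ψ.toFun (δ₂.toFun x)) = x := (chart hg₂).apply_pullback _ hb₂ x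
    rw [← hα₂ _ (h ▸ x.2), h]
  -- `HasTreeMap` ties the language part of `α` to that of the chart so that the two cancel here.
  obtain ⟨Y, E, β₁, β₂, hβ₁, hβ₂, hE⟩ := exists_isFreeAmalgam (α₁.comp δ₁) (α₂.comp δ₂)
    (show α₁.lang * (g₁.1 * S.ψ.lang)⁻¹ = 1 by rw [hl₁, mul_inv_cancel])
    (show α₂.lang * (g₂.1 * S.ψ.lang)⁻¹ = 1 by rw [hl₂, mul_inv_cancel])
  have hcomm : ∀ x ∈ C₁.carrier, x ∈ C₂.carrier → β₁.toFun (f₁ x) = β₂.toFun (f₂ x) := by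
    intro x hx₁ hx₂
    have h : β₁.toFun (α₁.toFun (δ₁.toFun ⟨x, hx₁, hx₂⟩)) =
        β₂.toFun (α₂.toFun (δ₂.toFun ⟨x, hx₁, hx₂⟩)) :=
      congrArg (fun e : Emb (C₁.inter C₂).str E => e.toFun ⟨x, hx₁, hx₂⟩) hE.comm
    rwa [hδ₁, hδ₂] at h
  let f : S.U → Y := fun x => if x ∈ C₁.carrier then β₁.toFun (f₁ x) else β₂.toFun (f₂ x)
  have hfx₁ : ∀ x ∈ C₁.carrier, f x = β₁.toFun (f₁ x) := fun x hx => if_pos hx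
  have hfx₂ : ∀ x ∈ C₂.carrier, f x = β₂.toFun (f₂ x) := fun x hx => by
    by_cases h : x ∈ C₁.carrier
    · rw [hfx₁ x h, hcomm x h hx]
    · exact if_neg h
  refine ⟨Y, E, .amalgam hD₁ hD₂ α₁ α₂ δ₁ δ₂ β₁ β₂ hE, f, fun K hK hcl => ?_⟩
  have hside : K.carrier ⊆ C₁.carrier ∨ K.carrier ⊆ C₂.carrier := by
    by_contra hcon
    rw [not_or, Set.not_subset, Set.not_subset] at hcon
    obtain ⟨⟨b, hb, hb'⟩, a, ha, ha'⟩ := hcon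
    have h₁ : a ∈ C₁.carrier := ((hU ▸ hK ha : a ∈ C₁.carrier ∪ C₂.carrier)).resolve_right ha'
    have h₂ : b ∈ C₂.carrier := ((hU ▸ hK hb : b ∈ C₁.carrier ∪ C₂.carrier)).resolve_left hb'
    exact hsep a h₁ ha' b h₂ hb' (hcl a ha b hb)
  rcases hside with h | h
  · obtain ⟨g, hg, hb, α, hl, hα⟩ := hf₁ K h hcl
    refine ⟨g, hg, hb, β₁.comp α, ?_, fun a ha => ?_⟩
    · rw [← hl, ← one_mul α.lang, ← hβ₁]
      rfl
    · rw [hfx₁ _ (h ha), hα a ha]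
      rfl
  · obtain ⟨g, hg, hb, α, hl, hα⟩ := hf₂ K h hcl
    refine ⟨g, hg, hb, β₂.comp α, ?_, fun a ha => ?_⟩
    · rw [← hl, ← one_mul α.lang, ← hβ₂]
      rfl
    · rw [hfx₂ _ (h ha), hα a ha]
      rfl

/-- Substructures without twisted sets map to tree amalgamations. -/
theorem hasTreeMap_of_not_twisted (hS : S.Covered) (hS' : S.Conformal) (C : Substr S.B)
    (hC : ∀ M ⊆ C.carrier, ¬ S.Twisted M) : S.HasTreeMap C := by
  have := S.fin
  induction hn : C.carrier.ncard using Nat.strong_induction_on generalizing C with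
  | _ n ih =>
    by_cases hcl : ∀ x ∈ C.carrier, ∀ y ∈ C.carrier, S.Adj x y
    · exact hasTreeMap_of_clique hS hS' C hcl
    · push Not at hcl
      obtain ⟨x, hx, y, hy, hxy⟩ := hcl
      obtain ⟨C₁, C₂, hU, hx₁, hy₂, hI, hsep⟩ := exists_separation hS C hC hx hy hxy
      have hs₁ : C₁.carrier ⊆ C.carrier := hU ▸ Set.subset_union_left
      have hs₂ : C₂.carrier ⊆ C.carrier := hU ▸ Set.subset_union_right
      refine hasTreeMap_of_separation hU hI hsep
        (ih _ ?_ C₁ (fun M hM => hC M (hM.trans hs₁)) rfl)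
        (ih _ ?_ C₂ (fun M hM => hC M (hM.trans hs₂)) rfl)
      · rw [← hn]
        exact Set.ncard_lt_ncard ⟨hs₁, fun h => hx₁ (h hx)⟩ (Set.toFinite _)
      · rw [← hn]
        exact Set.ncard_lt_ncard ⟨hs₂, fun h => hy₂ (h hy)⟩ (Set.toFinite _)

end Stage

end GStr

/-! ### Homomorphism-embeddings from blockwise embeddings, and iterated unwinding. -/

namespace GStr

open Equiv

variable {L : PermLang.{u, v}} {V : Type w}

namespace Stage

variable {A : GStr L V} {c : Prop} {S T : Stage A c}

/-- The map `f` restricts to an embedding on the part of every copy of `A` in `C`. -/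
def EmbOnBlocks {Z : Type*} (S : Stage A c) (C : Set S.U) (D : GStr L Z) (f : S.U → Z) : Prop :=
  ∀ g ∈ S.G, ∀ K : Substr S.B, K.carrier ⊆ C → K.carrier ⊆ S.block g →
    ∃ e : Emb K.str D, e.lang = 1 ∧ ∀ x, e.toFun x = f x

/-- The intersection of a substructure with a copy of `A`. -/
def interBlock {g : L.Γ × Perm S.U} (C : Substr S.B) (hg : g ∈ S.G) : Substr S.B :=
  C.inter (chart hg).range

/-- Relations and function values can be checked inside single blocks because the stage is covered,
and by conformality an irreducible substructure lies in one block. -/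
theorem EmbOnBlocks.exists_hom (hS : S.Covered) (hS' : S.Conformal) {Y Z : Type*} {E : GStr L Y}
    (i : Emb E S.B) (hi : i.lang = 1) {D : GStr L Z} {f : S.U → Z}
    (hf : S.EmbOnBlocks (Set.range i.toFun) D f) : ∃ h : Hom E D, h.IsHomEmbedding := by
  have hrel : ∀ {k : ℕ} (R : L.Rel k) (x : Fin (k + 1) → Y), x ∈ E.rel R →
      (fun j => f (i.toFun (x j))) ∈ D.rel (PermLang.onRel (1 : L.Γ) R) := by
    intro k R x hx
    have hx' := i.map_rel R x hx
    rw [hi] at hx'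
    obtain ⟨g, hg, h⟩ := hS.rel k _ _ hx'
    obtain ⟨e, he, he'⟩ := hf g hg (interBlock i.range hg) Set.inter_subset_left
      Set.inter_subset_right
    have := e.map_rel R (fun j => ⟨i.toFun (x j), ⟨x j, rfl⟩, h j⟩) hx'
    rw [he] at this
    simp only [he'] at this
    exact this
  have hfn : ∀ F x, (fun y => f (i.toFun y)) '' E.fn F x ⊆
      D.fn (PermLang.onFn (1 : L.Γ) F) (f (i.toFun x)) := by
    rintro F x _ ⟨y, hy, rfl⟩
    have hy' := i.map_fn F x ⟨y, hy, rfl⟩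
    rw [hi] at hy'
    obtain ⟨g, hg, h⟩ := hS.vertex (i.toFun x)
    obtain ⟨e, he, he'⟩ := hf g hg (interBlock i.range hg) Set.inter_subset_left
      Set.inter_subset_right
    have := e.map_fn F ⟨i.toFun x, ⟨x, rfl⟩, h⟩
      ⟨⟨i.toFun y, ⟨y, rfl⟩, block_closed hg _ _ h hy'⟩, hy', rfl⟩
    rw [he] at this
    simp only [he'] at this
    exact this
  refine ⟨⟨1, fun y => f (i.toFun y), hrel, hfn⟩, fun K hK => ?_⟩
  obtain ⟨g, hg, h⟩ := hS.range_subset_block hS' hK (i.comp K.incl)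
  obtain ⟨e, he, he'⟩ := hf g hg (i.comp K.incl).range
    (by rintro _ ⟨x, rfl⟩; exact ⟨_, rfl⟩) h
  have : Hom.comp ⟨1, fun y => f (i.toFun y), hrel, hfn⟩ K.incl.toHom =
      (e.comp (i.comp K.incl).toRange).toHom := by
    refine Hom.ext' ?_ fun x => (he' ((i.comp K.incl).toRange.toFun x)).symm
    change (1 : L.Γ) * 1 = e.lang * (i.lang * 1)
    rw [he, hi, mul_one, mul_one]
  rw [this]
  exact (e.comp (i.comp K.incl).toRange).isEmbedding

theorem IsProj.comp {R : Stage A c} {p : S.U → R.U} {q : T.U → S.U} (hp : S.IsProj R p)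
    (hq : T.IsProj S q) : T.IsProj R (fun x => p (q x)) where
  lang_eq := hq.lang_eq.trans hp.lang_eq
  block g hg := by
    obtain ⟨h, hh, e, h₁⟩ := hq.block g hg
    obtain ⟨k, hk, e', h₂⟩ := hp.block h hh
    exact ⟨k, hk, e.trans e', fun a => by rw [h₁, h₂]⟩

/-- On a block the projection is the inverse of the upper chart followed by the lower chart; their
language parts agree and cancel. -/
theorem IsProj.exists_emb {p : T.U → S.U} (hp : T.IsProj S p) {g : L.Γ × Perm T.U}
    (hg : g ∈ T.G) (K : Substr T.B) (hK : K.carrier ⊆ T.block g) :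
    ∃ h ∈ S.G, ∃ e : Emb K.str S.B, e.lang = 1 ∧ (∀ x, e.toFun x = p x) ∧
      Set.range e.toFun ⊆ S.block h := by
  obtain ⟨h, hh, hgh, hpa⟩ := hp.block g hg
  refine ⟨h, hh, (chart hh).comp ((chart hg).pullback K hK), ?_, fun x => ?_, ?_⟩
  · change h.1 * S.ψ.lang * (g.1 * T.ψ.lang)⁻¹ = 1
    rw [hgh, hp.lang_eq, mul_inv_cancel]
  · have e : g.2 (T.ψ.toFun (((chart hg).pullback K hK).toFun x)) = x :=
      (chart hg).apply_pullback K hK x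
    rw [← e, hpa]
    rfl
  · rintro _ ⟨x, rfl⟩
    exact ⟨_, rfl⟩

theorem IsProj.embOnBlocks {p : T.U → S.U} (hp : T.IsProj S p) (C : Set T.U) :
    T.EmbOnBlocks C S.B p := by
  intro g hg K _ hK
  obtain ⟨_, _, e, he, he', -⟩ := hp.exists_emb hg K hK
  exact ⟨e, he, he'⟩

/-- The image of a substructure under a projection. -/
def IsProj.image {p : T.U → S.U} (hp : T.IsProj S p) (hT : T.Covered) (C : Substr T.B) :
    Substr S.B where
  carrier := p '' C.carrier
  closed := by
    rintro F _ ⟨x, hx, rfl⟩ y hy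
    obtain ⟨g, hg, h⟩ := hT.vertex x
    obtain ⟨_, _, e, he, he', -⟩ := hp.exists_emb hg (interBlock C hg) Set.inter_subset_right
    have hcl := e.range.closed F (p x) ⟨⟨x, hx, h⟩, he' _⟩ hy
    obtain ⟨z, rfl⟩ := hcl
    exact ⟨z, z.2.1, (he' z).symm⟩

theorem IsProj.embOnBlocks_comp {p : T.U → S.U} (hp : T.IsProj S p) (hT : T.Covered)
    (C : Substr T.B) {Z : Type*} {D : GStr L Z} {f : S.U → Z}
    (hf : S.EmbOnBlocks (hp.image hT C).carrier D f) :
    T.EmbOnBlocks C.carrier D (fun x => f (p x)) := by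
  intro g hg K hKC hK
  obtain ⟨h, hh, e, he, he', hr⟩ := hp.exists_emb hg K hK
  obtain ⟨e₁, h₁, h₁'⟩ := hf h hh e.range (by
    rintro _ ⟨x, rfl⟩
    exact ⟨x, hKC x.2, (he' x).symm⟩) hr
  refine ⟨e₁.comp e.toRange, ?_, fun x => ?_⟩
  · change e₁.lang * e.lang = 1
    rw [h₁, he, mul_one]
  · exact (h₁' _).trans (congrArg f (he' x))

/-- `C` maps to a tree amalgamation of copies of `A`. -/
def HasTreeEmb (S : Stage A c) (C : Set S.U) : Prop :=
  ∃ (Z : Type w) (D : GStr L Z), IsTreeAmalgam A D ∧ ∃ f : S.U → Z, S.EmbOnBlocks C D f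

theorem HasTreeMap.hasTreeEmb {C : Substr S.B} (h : S.HasTreeMap C) :
    S.HasTreeEmb C.carrier := by
  obtain ⟨Z, D, hD, f, hf⟩ := h
  refine ⟨Z, D, hD, f, fun g₀ hg₀ K hKC hK₀ => ?_⟩
  obtain ⟨g, hg, hK, α, hl, hα⟩ := hf K hKC fun x hx y hy => ⟨g₀, hg₀, hK₀ hx, hK₀ hy⟩
  refine ⟨α.comp ((chart hg).pullback K hK), ?_, fun x => ?_⟩
  · change α.lang * (g.1 * S.ψ.lang)⁻¹ = 1
    rw [hl, mul_inv_cancel]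
  · have e : g.2 (S.ψ.toFun (((chart hg).pullback K hK).toFun x)) = x :=
      (chart hg).apply_pullback K hK x
    have := hα _ (by rw [e]; exact x.2)
    rw [e] at this
    exact this.symm

/-- The pairs of vertices of `C` which do not lie in a common copy of `A`. -/
def nonadj (S : Stage A c) (C : Set S.U) : Set (S.U × S.U) :=
  {q | q.1 ∈ C ∧ q.2 ∈ C ∧ ¬ S.Adj q.1 q.2}

theorem IsProj.nonadj_image {p : T.U → S.U} (hp : T.IsProj S p) (C : Set T.U) :
    S.nonadj (p '' C) ⊆
      Prod.map p p '' {q | q ∈ T.nonadj C ∧ ¬ S.Adj (p q.1) (p q.2)} := by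
  rintro ⟨_, _⟩ ⟨⟨x, hx, rfl⟩, ⟨y, hy, rfl⟩, h⟩
  exact ⟨(x, y), ⟨⟨hx, hy, fun h' => h (hp.adj h')⟩, h⟩, rfl⟩

/-- Projections preserve adjacency, so nonadjacent pairs of the image come from nonadjacent pairs. A
vertex is lost if `p` is not injective on `C`, and a nonadjacent pair otherwise. -/
theorem IsProj.measure_lt {p : T.U → S.U} (hp : T.IsProj S p) {C : Set T.U}
    (h : ¬ (Set.InjOn p C ∧ ∀ x ∈ C, ∀ y ∈ C, S.Adj (p x) (p y) → T.Adj x y)) :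
    (p '' C).ncard + (S.nonadj (p '' C)).ncard < C.ncard + (T.nonadj C).ncard := by
  have := S.fin
  have := T.fin
  have h₁ : (p '' C).ncard ≤ C.ncard := Set.ncard_image_le (Set.toFinite _)
  have h₂ : (S.nonadj (p '' C)).ncard ≤
      {q | q ∈ T.nonadj C ∧ ¬ S.Adj (p q.1) (p q.2)}.ncard :=
    (Set.ncard_le_ncard (hp.nonadj_image C) (Set.toFinite _)).trans
      (Set.ncard_image_le (Set.toFinite _))
  have hsub : {q | q ∈ T.nonadj C ∧ ¬ S.Adj (p q.1) (p q.2)} ⊆ T.nonadj C := fun q hq => hq.1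
  by_cases hinj : Set.InjOn p C
  · rw [not_and] at h
    have h' := h hinj
    push Not at h'
    obtain ⟨x, hx, y, hy, hxy, hxy'⟩ := h'
    have : {q | q ∈ T.nonadj C ∧ ¬ S.Adj (p q.1) (p q.2)}.ncard < (T.nonadj C).ncard := by
      refine Set.ncard_lt_ncard ⟨hsub, fun hcon => ?_⟩ (Set.toFinite _)
      have : (x, y) ∈ T.nonadj C := ⟨hx, hy, hxy'⟩
      exact (hcon this).2 hxy
    omega
  · have : (p '' C).ncard ≠ C.ncard := fun e => hinj ((Set.ncard_image_iff (Set.toFinite _)).1 e)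
    have := Set.ncard_le_ncard hsub (Set.toFinite _)
    omega

/-- Unwinding a stage until all small substructures map to tree amalgamations. -/
theorem exists_unwinding (S : Stage A c) (k : ℕ) : ∃ T : Stage A c, T.Covered ∧ T.Conformal ∧
    (∃ p, T.IsProj S p) ∧ ∀ C : Substr T.B,
      C.carrier.ncard + (T.nonadj C.carrier).ncard ≤ k → T.HasTreeEmb C.carrier := by
  induction k with
  | zero =>
    -- One clique cover at the start makes the stage conformal, and the later twist covers keep it
    -- so. Only the empty substructure has measure 0.
    refine ⟨S.cliqueSystem.cover, LocalSystem.cover_covered, cliqueSystem_conformal,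
      ⟨_, LocalSystem.cover_isProj⟩, fun C hC => ?_⟩
    have := S.cliqueSystem.cover.fin
    have h₀ : C.carrier = ∅ := (Set.ncard_eq_zero (Set.toFinite _)).1 (by omega)
    refine (hasTreeMap_of_clique LocalSystem.cover_covered cliqueSystem_conformal C ?_).hasTreeEmb
    rw [h₀]
    exact fun x hx => hx.elim
  | succ k ih =>
    obtain ⟨T, hT, hT', ⟨p, hp⟩, h⟩ := ih
    have hq := LocalSystem.cover_isProj (Λ := T.twistSystem)
    refine ⟨T.twistSystem.cover, LocalSystem.cover_covered, twistSystem_conformal hT',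
      ⟨_, hp.comp hq⟩, fun C hC => ?_⟩
    have key : T.HasTreeEmb (hq.image LocalSystem.cover_covered C).carrier := by
      -- If the projection is an isomorphism of adjacency graphs on `C`, a twisted subset of the
      -- image would lift to the cover, which is impossible. Otherwise the measure drops and the
      -- induction hypothesis applies to the image.
      by_cases hiso : Set.InjOn (fun v => v.1.1) C.carrier ∧ ∀ x ∈ C.carrier, ∀ y ∈ C.carrier,
          T.Adj x.1.1 y.1.1 → T.twistSystem.cover.Adj x y
      · refine (hasTreeMap_of_not_twisted hT hT' _ fun M hM => ?_).hasTreeEmb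
        rcases M.eq_empty_or_nonempty with rfl | ⟨m, hm⟩
        · exact fun h => h.potential ⟨0, fun x hx => hx.elim⟩
        have : Nonempty T.twistSystem.cover.U := ⟨(hM hm).choose⟩
        have hM' : ∀ x ∈ M, ∃ v ∈ C.carrier, v.1.1 = x := fun x hx => hM hx
        choose! s hs using hM'
        refine not_twisted_of_lift s (fun x hx => (hs x hx).2) fun x hx y hy hxy => ?_
        refine hiso.2 _ (hs x hx).1 _ (hs y hy).1 ?_
        rwa [(hs x hx).2, (hs y hy).2]
      · have := hq.measure_lt hiso
        exact h _ (Nat.le_of_lt_succ (this.trans_le hC))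
    obtain ⟨Z, D, hD, f, hf⟩ := key
    exact ⟨Z, D, hD, _, hq.embOnBlocks_comp LocalSystem.cover_covered C hf⟩

/-- On `n` vertices there are at most n² ordered nonadjacent pairs. -/
theorem exists_small_unwinding (S : Stage A c) (n : ℕ) : ∃ T : Stage A c, T.Covered ∧
    T.Conformal ∧ (∃ p, T.IsProj S p) ∧ ∀ C : Substr T.B,
      C.carrier.ncard ≤ n → T.HasTreeEmb C.carrier := by
  obtain ⟨T, hT, hT', hp, h⟩ := S.exists_unwinding (n + n * n)
  refine ⟨T, hT, hT', hp, fun C hC => h C (Nat.add_le_add hC ?_)⟩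
  have := T.fin
  have hsub : T.nonadj C.carrier ⊆ C.carrier ×ˢ C.carrier := fun q hq => ⟨hq.1, hq.2.1⟩
  refine (Set.ncard_le_ncard hsub (Set.toFinite _)).trans ?_
  rw [Set.ncard_prod]
  exact Nat.mul_le_mul hC hC

end Stage

/-! ### Passing between partial automorphisms of A and of its copy; witnesses as stages. -/

section Transport

variable {W : Type*} {A : GStr L V} {A' : GStr L W}

/-- A partial automorphism as an embedding of its domain in its range. -/
def PartialAut.emb (f : PartialAut A) : Emb f.dom.str f.ran.str := ⟨f.map, f.isIso.toIsEmbedding⟩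

/-- The image of a substructure under an embedding. -/
def Emb.image (i : Emb A A') (S : Substr A) : Substr A' := (i.comp S.incl).range

/-- The image of a partial automorphism under an embedding. -/
noncomputable def PartialAut.push (i : Emb A A') (f : PartialAut A) : PartialAut A' where
  dom := i.image f.dom
  ran := i.image f.ran
  map := ((i.comp f.ran.incl).toRange.comp
    (f.emb.comp ((i.comp f.dom.incl).pullback (i.image f.dom) Set.Subset.rfl))).toHom
  isIso :=
    { toIsEmbedding := Emb.isEmbedding _
      surjective := by
        refine (i.comp f.ran.incl).toRange_isIso.surjective.comp
          (f.isIso.surjective.comp fun x => ?_)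
        refine ⟨(i.comp f.dom.incl).toRange.toFun x, ?_⟩
        apply (i.comp f.dom.incl).isEmbedding.injective
        exact Emb.apply_pullback _ _ _ _ }

theorem PartialAut.push_lang (i : Emb A A') (f : PartialAut A) :
    (f.push i).map.lang = i.lang * f.map.lang * i.lang⁻¹ := by
  change i.lang * 1 * (f.map.lang * (i.lang * 1)⁻¹) = _
  rw [mul_one, mul_assoc]

theorem PartialAut.push_apply (i : Emb A A') (f : PartialAut A) (a : f.dom.carrier)
    (h : i.toFun a ∈ (f.push i).dom.carrier) :
    ((f.push i).map ⟨i.toFun a, h⟩ : W) = i.toFun (f.map a) := by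
  have : ((i.comp f.dom.incl).pullback (i.image f.dom) Set.Subset.rfl).toFun ⟨i.toFun a, h⟩ = a :=
    (i.comp f.dom.incl).isEmbedding.injective (Emb.apply_pullback _ _ _ _)
  exact congrArg (fun b => i.toFun (f.map b)) this

theorem CoherentTriple.push (i : Emb A A') {f g h : PartialAut A} (H : CoherentTriple f g h) :
    CoherentTriple (f.push i) (g.push i) (h.push i) where
  dom_eq := congrArg i.image H.dom_eq
  mid_eq := congrArg i.image H.mid_eq
  ran_eq := congrArg i.image H.ran_eq
  lang_eq := by
    rw [PartialAut.push_lang, PartialAut.push_lang, PartialAut.push_lang, H.lang_eq]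
    group
  map_eq := by
    intro x hf hg hh
    obtain ⟨a, rfl⟩ := hf
    obtain ⟨a, ha⟩ := a
    have ha' : a ∈ h.dom.carrier := H.dom_eq ▸ ha
    have hb : (f.map ⟨a, ha⟩ : V) ∈ g.dom.carrier := H.mid_eq ▸ (f.map ⟨a, ha⟩).2
    have e₁ := f.push_apply i ⟨a, ha⟩ ⟨⟨a, ha⟩, rfl⟩
    have e₂ := g.push_apply i ⟨_, hb⟩ ⟨⟨_, hb⟩, rfl⟩
    have e₃ := h.push_apply i ⟨a, ha'⟩ ⟨⟨a, ha'⟩, rfl⟩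
    have e₄ : (g.push i).map ⟨_, hg⟩ = (g.push i).map ⟨_, ⟨⟨_, hb⟩, rfl⟩⟩ :=
      congrArg _ (Subtype.ext e₁)
    refine e₃.trans ((congrArg i.toFun (H.map_eq a ha hb ha')).trans (e₂.symm.trans ?_))
    exact congrArg Subtype.val e₄.symm

end Transport

/-- Extensions of partial automorphisms, coherent if the structure is a coherent witness. -/
theorem IsEPPAWitness.exists_extension {W : Type*} {A : GStr L V} {B : GStr L W}
    (hB : IsEPPAWitness A B) : ∃ (ψ : Emb A B) (φ : PartialAut ψ.range.str → Hom B B),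
      (∀ f, (φ f).IsIso ∧ Extends (φ f) f) ∧ (IsCoherentEPPAWitness A B →
        ∀ f g h, CoherentTriple f g h → φ h = (φ g).comp (φ f)) := by
  -- A coherent choice is taken whenever there is one; otherwise the coherence clause is vacuous.
  by_cases hc : IsCoherentEPPAWitness A B
  · obtain ⟨ψ, φ, hφ, hcoh⟩ := hc
    exact ⟨ψ, φ, hφ, fun _ => hcoh⟩
  · obtain ⟨ψ, hψ⟩ := hB
    choose φ hφ using hψ
    exact ⟨ψ, φ, hφ, fun h => (hc h).elim⟩

namespace Stage

variable {A : GStr L V} {c : Prop}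

/-- The stage given by an EPPA-witness. -/
noncomputable def ofWitness {W : Type w} [Finite W] {B : GStr L W} (ψ : Emb A B)
    (φ : PartialAut ψ.range.str → Hom B B) (hφ : ∀ f, (φ f).IsIso ∧ Extends (φ f) f)
    (hc : c → ∀ f g h, CoherentTriple f g h → φ h = (φ g).comp (φ f)) : Stage A c where
  U := W
  fin := inferInstance
  B := B
  ψ := ψ
  G := B.autGroup
  G_le := le_rfl
  φ f := autOfHom (φ (f.push ψ.toRange)) (hφ _).1
  φ_mem f := autOfHom_mem _ _
  φ_lang f := (hφ _).2.1.trans (PartialAut.push_lang _ _)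
  φ_map f a ha := by
    refine ((hφ (f.push ψ.toRange)).2.2 ⟨ψ.toRange.toFun a, ⟨⟨a, ha⟩, rfl⟩⟩).trans ?_
    exact congrArg Subtype.val (f.push_apply ψ.toRange ⟨a, ha⟩ ⟨⟨a, ha⟩, rfl⟩)
  coh h f g k H := by
    have := hc h _ _ _ (H.push ψ.toRange)
    refine Prod.ext (congrArg Hom.lang this) (Equiv.ext fun x => ?_)
    exact congrArg (fun e : Hom B B => e.toFun x) this

/-- The automorphisms extending the partial automorphisms of the copy of `A`. -/
noncomputable def extension (S : Stage A c) (f : PartialAut S.ψ.range.str) : Hom S.B S.B :=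
  homOfAut (S.φ (f.push (S.ψ.pullback S.ψ.range Set.Subset.rfl))) (S.G_le (S.φ_mem _))

theorem extension_spec (S : Stage A c) (f : PartialAut S.ψ.range.str) :
    (S.extension f).IsIso ∧ Extends (S.extension f) f := by
  refine ⟨homOfAut_isIso _ _, ?_, fun x => ?_⟩
  · refine (S.φ_lang _).trans ?_
    rw [PartialAut.push_lang]
    change S.ψ.lang * (S.ψ.lang⁻¹ * f.map.lang * S.ψ.lang⁻¹⁻¹) * S.ψ.lang⁻¹ = _
    group
  · let i := S.ψ.pullback S.ψ.range Set.Subset.rfl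
    have hi : ∀ y : S.ψ.range.carrier, S.ψ.toFun (i.toFun y) = y :=
      S.ψ.apply_pullback S.ψ.range Set.Subset.rfl
    have h := S.φ_map (f.push i) (i.toFun x.1) ⟨x, rfl⟩
    have e := f.push_apply i x ⟨x, rfl⟩
    rw [e, hi, hi] at h
    exact h

theorem isEPPAVia (S : Stage A c) : IsEPPAVia S.ψ := fun f => ⟨_, S.extension_spec f⟩

theorem isCoherentVia (S : Stage A c) (hc : c) : IsCoherentVia S.ψ :=
  ⟨S.extension, S.extension_spec, fun f g h H => by
    have := S.coh hc _ _ _ (H.push (S.ψ.pullback S.ψ.range Set.Subset.rfl))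
    refine Hom.ext' (congrArg Prod.fst this) fun x => ?_
    exact congrArg (fun e : L.Γ × Perm S.U => e.2 x) this⟩

end Stage

/-- The identity embedding. -/
def Emb.id {W : Type*} (B : GStr L W) : Emb B B where
  lang := 1
  toFun x := x
  map_rel _ _ hx := hx
  map_fn F x := by simp
  isEmbedding := ⟨fun _ _ h => h, fun _ _ => Iff.rfl, fun F x => by simp⟩

end GStr

theorem theorem1p2 {L : PermLang.{u, v}} {V W : Type w} [Finite V] [Finite W]
    (A : GStr L V) (hA : A.Irreducible)
    (B₀ : GStr L W) (hB₀ : GStr.IsEPPAWitness A B₀) (n : ℕ) (hn : 1 ≤ n) :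
    ∃ (U : Type w) (_ : Finite U) (B : GStr L U) (ψ : GStr.Emb A B),
      GStr.IsEPPAVia ψ ∧ GStr.IsFaithfulVia ψ ∧
      (∃ f : GStr.Hom B B₀, f.IsHomEmbedding) ∧
      (∀ C : GStr.Substr B, C.carrier.ncard ≤ n →
        ∃ (Z : Type w) (D : GStr L Z), GStr.IsTreeAmalgam A D ∧
          ∃ f : GStr.Hom C.str D, f.IsHomEmbedding) ∧
      (GStr.IsCoherentEPPAWitness A B₀ → GStr.IsCoherentVia ψ) := by
  -- The parameter `c` of the stages is the proposition that `B₀` is a coherent witness, so one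
  -- embedding serves all the conclusions.
  obtain ⟨ψ₀, φ₀, hφ₀, hcoh⟩ := hB₀.exists_extension
  obtain ⟨T, hT, hT', ⟨p, hp⟩, h⟩ :=
    (GStr.Stage.ofWitness ψ₀ φ₀ hφ₀ hcoh).exists_small_unwinding n
  refine ⟨T.U, T.fin, T.B, T.ψ, T.isEPPAVia, hT.isFaithfulVia hT', ?_, fun C hC => ?_,
    T.isCoherentVia⟩
  · exact (hp.embOnBlocks _).exists_hom hT hT' (GStr.Emb.id T.B) rfl
  · obtain ⟨Z, D, hD, f, hf⟩ := h C hC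
    refine ⟨Z, D, hD, GStr.Stage.EmbOnBlocks.exists_hom hT hT' C.incl rfl (f := f) ?_⟩
    have : Set.range C.incl.toFun = C.carrier := Subtype.range_coe
    rwa [this]
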